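/- Let $A\in\mathbb{Z}^{m\times n}$ have rank $m$, and let $\mathbf{c}\in\mathbb{Q}^n$ satisfy $\mathbf{c}^\intercal\mathbf{x}\le 0$ for every $\mathbf{x}\in\mathbb{R}^n_{\ge 0}$ with $A\mathbf{x}=\mathbf{0}$. For $\mathbf{b}\in\mathbb{Z}^m$ let $\operatorname{IP}(\mathbf{b})$ be the problem $\max\{\mathbf{c}^\intercal\mathbf{z}: A\mathbf{z}=\mathbf{b},\ \mathbf{z}\in\mathbb{Z}^n_{\ge 0}\}$ and $\operatorname{LP}(\mathbf{b})$ its relaxation $\max\{\mathbf{c}^\intercal\mathbf{x}: A\mathbf{x}=\mathbf{b},\ \mathbf{x}\in\mathbb{R}^n_{\ge 0}\}$. Assume that for every $\mathbf{b}\in\mathbb{Z}^m$ for which $\operatorname{IP}(\mathbf{b})$ is feasible, $\operatorname{LP}(\mathbf{b})$ has a unique optimal solution, denoted $\mathbf{x}^*(\mathbf{b})$. Define \[ \pi(\mathbf{b})=\min\{\|\mathbf{x}^*(\mathbf{b})-\mathbf{z}^*\|_1 : \mathbf{z}^*\text{ optimal for }\operatorname{IP}(\mathbf{b})\},\qquad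 \pi^\infty(\mathbf{b})=\min\{\|\mathbf{x}^*(\mathbf{b})-\mathbf{z}^*\|_\infty : \mathbf{z}^*\text{ optimal for }\operatorname{IP}(\mathbf{b})\}, \] both set to $\infty$ if $\operatorname{IP}(\mathbf{b})$ is infeasible. Let $\delta$ and $\gamma$ be the maximum and the greatest common divisor, respectively, of the numbers $|\det B|$ over all $m\times m$ submatrices $B$ of $A$. For $f\in\{\pi,\pi^\infty\}$ and real $\alpha\ge 0$ let \[ \Pr(f\le\alpha)=\liminf_{t\to\infty}\frac{|\{\mathbf{b}\in\mathbb{Z}^m:\|\mathbf{b}\|_\infty\le t,\ f(\mathbf{b})\le\alpha\}|}{|\{\mathbf{b}\in\mathbb{Z}^m:\|\mathbf{b}\|_\infty\le t,\ f(\mathbf{b})<\infty\}|}. \] Then for each integer $k\in\{0,\dots,\gamma^{-1}\delta-1\}$: (a) $\displaystyle \Pr\Bigl(\pi\le m\,\gamma^{-1}\delta\cdot\frac{k}{k+1}+k\Bigr)\ \ge\ \frac{k+1}{\gamma^{-1}\delta}$, and (b) $\displaystyle \Pr\Bigl(\pi^\infty\le \gamma^{-1}\delta\cdot\frac{k}{k+1}\Bigr)\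 \ge\ \frac{k+1}{\gamma^{-1}\delta}$. In particular, $\Pr\bigl(\pi\le (m+1)(\gamma^{-1}\delta-1)\bigr)=1$ and $\Pr\bigl(\pi^\infty\le\gamma^{-1}\delta-1\bigr)=1$. -/

import Mathlib

open Filter
open scoped ENNReal

noncomputable section

namespace ParamIP

variable {m n : ℕ}

/-- The largest absolute value `δ` of the determinants of the `m × m` submatrices of `A`.
An `m × m` submatrix is given by an injective choice of `m` columns; the order in which the columns
are listed does not change the absolute value of the determinant. -/
def maxMinor (A : Matrix (Fin m) (Fin n) ℤ) : ℕ :=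
  Finset.univ.sup fun e : Fin m ↪ Fin n => (A.submatrix id e).det.natAbs

/-- The greatest common divisor `γ` of the absolute values of the determinants of the `m × m`
submatrices of `A`. -/
def gcdMinor (A : Matrix (Fin m) (Fin n) ℤ) : ℕ :=
  Finset.univ.gcd fun e : Fin m ↪ Fin n => (A.submatrix id e).det.natAbs

/-- The real number `γ⁻¹ · δ`. -/
def normMinor (A : Matrix (Fin m) (Fin n) ℤ) : ℝ :=
  (gcdMinor A : ℝ)⁻¹ * (maxMinor A : ℝ)

/-- `x` is feasible for the linear program `LP(b)`: `A x = b`, `x ∈ ℝⁿ`, `x ≥ 0`. -/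
def LPFeasible (A : Matrix (Fin m) (Fin n) ℤ) (b : Fin m → ℤ) (x : Fin n → ℝ) : Prop :=
  (A.map (Int.cast : ℤ → ℝ)).mulVec x = (fun i => (b i : ℝ)) ∧ ∀ j, 0 ≤ x j

/-- `z` is feasible for the integer program `IP(b)`: `A z = b`, `z ∈ ℤⁿ`, `z ≥ 0`. -/
def IPFeasible (A : Matrix (Fin m) (Fin n) ℤ) (b : Fin m → ℤ) (z : Fin n → ℤ) : Prop :=
  A.mulVec z = b ∧ ∀ j, 0 ≤ z j

/-- `x` is an optimal solution to `LP(b)`, that is, `x` maximizes `cᵀ x` over the feasible set. -/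
def LPOptimal (A : Matrix (Fin m) (Fin n) ℤ) (c : Fin n → ℚ) (b : Fin m → ℤ)
    (x : Fin n → ℝ) : Prop :=
  LPFeasible A b x ∧
    ∀ y, LPFeasible A b y → ∑ j, (c j : ℝ) * y j ≤ ∑ j, (c j : ℝ) * x j

/-- `z` is an optimal solution to `IP(b)`, that is, `z` maximizes `cᵀ z` over the feasible set. -/
def IPOptimal (A : Matrix (Fin m) (Fin n) ℤ) (c : Fin n → ℚ) (b : Fin m → ℤ)
    (z : Fin n → ℤ) : Prop :=
  IPFeasible A b z ∧
    ∀ y, IPFeasible A b y → ∑ j, c j * (y j : ℚ) ≤ ∑ j, c j * (z j : ℚ)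

/-- The optimal solution `x*(b)` to `LP(b)`; used where it exists and is unique. -/
def lpOpt (A : Matrix (Fin m) (Fin n) ℤ) (c : Fin n → ℚ) (b : Fin m → ℤ) : Fin n → ℝ :=
  Classical.epsilon (LPOptimal A c b)

/-- The distance function `π(b)`: the smallest `ℓ₁`-distance from `x*(b)` to an optimal solution
of `IP(b)`. It is `∞` if `IP(b)` has no optimal solution. (An infimum of distances from a point to a
nonempty set of integer vectors is a minimum.) -/
def distOne (A : Matrix (Fin m) (Fin n) ℤ) (c : Fin n → ℚ) (b : Fin m → ℤ) : ℝ≥0∞ :=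
  ⨅ (z : Fin n → ℤ) (_ : IPOptimal A c b z),
    ENNReal.ofReal (∑ j, |lpOpt A c b j - (z j : ℝ)|)

/-- The distance function `π^∞(b)`: as `distOne`, with the `ℓ_∞`-norm (the norm of the function
space `Fin n → ℝ`). -/
def distSup (A : Matrix (Fin m) (Fin n) ℤ) (c : Fin n → ℚ) (b : Fin m → ℤ) : ℝ≥0∞ :=
  ⨅ (z : Fin n → ℤ) (_ : IPOptimal A c b z),
    ENNReal.ofReal ‖fun j => lpOpt A c b j - (z j : ℝ)‖

/-- `Pr_t(E)`: the proportion of `E` among the `b ∈ {-t, …, t}^m` with `f b < ∞`. -/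
def prT (f : (Fin m → ℤ) → ℝ≥0∞) (t : ℕ) (E : Set (Fin m → ℤ)) : ℝ :=
  (Set.ncard {b : Fin m → ℤ | b ∈ E ∧ ‖b‖ ≤ (t : ℝ) ∧ f b < ∞} : ℝ) /
    (Set.ncard {b : Fin m → ℤ | ‖b‖ ≤ (t : ℝ) ∧ f b < ∞} : ℝ)

/-- The lower asymptotic density `Pr(E) = liminf_{t → ∞} Pr_t(E)`. -/
def lowerDensity (f : (Fin m → ℤ) → ℝ≥0∞) (E : Set (Fin m → ℤ)) : ℝ :=
  liminf (fun t : ℕ => prT f t E) atTop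

/-- `Pr(f ≤ α)`, for real `α ≥ 0`. -/
def prLE (f : (Fin m → ℤ) → ℝ≥0∞) (α : ℝ) : ℝ :=
  lowerDensity f {b | f b ≤ ENNReal.ofReal α}

end ParamIP

end

open ParamIP

open scoped Topology

namespace ParamIP

/-! ### Lattice indices and the gcd of the maximal minors. -/

section

variable {m n : ℕ}

/-! Write `Δ = δ/γ`. A unique LP optimum is a vertex, so it is carried by a basis `e` with matrix
`B`. Unless `b` lies on one of finitely many hyperplanes the vertex is nondegenerate, and uniqueness
then makes every nonbasic reduced cost strict. So, up to these hyperplanes, the feasible `b` lie in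
cones of strict bases, and the interiors of these cones share no feasible `b`.

Inside one cone Gomory's group relaxation takes over. Choose a cheapest `y ≥ 0` in the class of `b`
in the finite group `Aℤⁿ / Bℤᵐ`. If `b = A y + B z` with `z ≥ 0`, then `y` plus `z` on the basis is
IP-optimal (`IsStrictBasis.ipOptimal`). Its nonbasic part differs from the LP vertex by `y` and its
basic part by `B⁻¹ A y`, which Cramer's rule bounds by `δ/|det B| · ‖y‖₁` (`abs_le_of_mulVec_eq`).

The heart is `IsStrictBasis.exists_finset_isGroupOptimal`: `k+1` classes, if there are that many,
have optimal solutions with `‖y‖₁ ≤ k`. The group has order `D` with `D γ ≤ |det B|`, hence `D ≤ Δ`,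
and `k+1` classes out of `D` are a share of at least `(k+1)/Δ`. Moreover `k+1 ≤ D` gives `|det B| ≥
(k+1)γ`, so the basic error is at most `Δ k/(k+1)`.

The density statement follows since the classes are equally frequent in the cone up to boundary
effects (`exists_cnt_coneSet_mul_le`), while boundary layers and hyperplanes are negligible against
the feasible `b`, which have positive lower density. -/

theorem gcdMinor_dvd_minor (A : Matrix (Fin m) (Fin n) ℤ) (f : Fin m ↪ Fin n) :
    (gcdMinor A : ℤ) ∣ (A.submatrix id f).det :=
  Int.natCast_dvd.2 (Finset.gcd_dvd (Finset.mem_univ f))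

theorem natAbs_minor_le_maxMinor (A : Matrix (Fin m) (Fin n) ℤ) (f : Fin m ↪ Fin n) :
    (A.submatrix id f).det.natAbs ≤ maxMinor A :=
  Finset.le_sup (f := fun e : Fin m ↪ Fin n => (A.submatrix id e).det.natAbs) (Finset.mem_univ f)

/-- A weak form of the Cauchy–Binet formula. -/
theorem gcdMinor_dvd_det_mul (A : Matrix (Fin m) (Fin n) ℤ) (U : Matrix (Fin n) (Fin m) ℤ) :
    (gcdMinor A : ℤ) ∣ (A * U).det := by
  have hrows : (A * U).transpose = fun i => ∑ j, U j i • A.transpose j := by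
    ext i k
    simp [Matrix.mul_apply, mul_comm, Finset.sum_apply]
  rw [← Matrix.det_transpose, hrows]
  have hexp := (Matrix.detRowAlternating (R := ℤ) (n := Fin m)).toMultilinearMap.map_sum
    (fun i j => U j i • A.transpose j)
  change (gcdMinor A : ℤ) ∣ Matrix.detRowAlternating.toMultilinearMap _
  rw [hexp]
  refine Finset.dvd_sum fun r _ => ?_
  rw [MultilinearMap.map_smul_univ, smul_eq_mul]
  refine Dvd.dvd.mul_left ?_ _
  change (gcdMinor A : ℤ) ∣ (A.submatrix id r).transpose.det
  rw [Matrix.det_transpose]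
  -- After multilinear expansion each term is a minor of `A`, or has a repeated column and vanishes.
  by_cases hr : Function.Injective r
  · exact gcdMinor_dvd_minor A ⟨r, hr⟩
  · obtain ⟨i, j, hij, hne⟩ := Function.not_injective_iff.1 hr
    rw [Matrix.det_zero_of_column_eq hne fun k => by simp [hij]]
    exact dvd_zero _

theorem card_quotient_range_eq_det (B : Matrix (Fin m) (Fin m) ℤ) (hB : B.det ≠ 0) :
    Nat.card ((Fin m → ℤ) ⧸ LinearMap.range B.mulVecLin) = B.det.natAbs := by
  have hinj : Function.Injective B.mulVecLin := by
    rw [← LinearMap.ker_eq_bot, LinearMap.ker_eq_bot']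
    intro v hv
    exact Matrix.eq_zero_of_mulVec_eq_zero hB hv
  rw [← Submodule.natAbs_det_equiv _ (LinearEquiv.ofInjective _ hinj)]
  have : ((LinearMap.range B.mulVecLin).subtype ∘ₗ AddMonoidHom.toIntLinearMap
      (LinearEquiv.ofInjective _ hinj : (Fin m → ℤ) →+ LinearMap.range B.mulVecLin))
      = Matrix.toLin' B := by
    ext; rfl
  rw [this, LinearMap.det_toLin']

/-- A basis of the lattice `Aℤⁿ` has the form `A U`, and its determinant is the index up to sign.
For infinite index `Nat.card` is `0`, which everything divides. -/
theorem gcdMinor_dvd_card_quotient (A : Matrix (Fin m) (Fin n) ℤ) :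
    gcdMinor A ∣ Nat.card ((Fin m → ℤ) ⧸ LinearMap.range A.mulVecLin) := by
  set N := LinearMap.range A.mulVecLin
  by_cases hfin : Finite ((Fin m → ℤ) ⧸ N)
  · have hrk := (Submodule.finiteQuotient_iff N).1 hfin
    rw [Module.finrank_fin_fun] at hrk
    let bN : Module.Basis (Fin m) ℤ N := Module.finBasisOfFinrankEq ℤ N hrk
    rw [← Submodule.natAbs_det_basis_change (Pi.basisFun ℤ (Fin m)) N bN]
    have hU : ∀ i, ∃ u : Fin n → ℤ, A.mulVec u = bN i := fun i => (bN i).2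
    choose u hu using hU
    have := gcdMinor_dvd_det_mul A (Matrix.of fun j i => u i j)
    rw [← Int.natCast_dvd, Module.Basis.det_apply]
    convert this using 2
    ext k i
    have := congrFun (hu i) k
    simp [Module.Basis.toMatrix_apply, Matrix.mul_apply, ← this, Matrix.mulVec, dotProduct]
  · have : Infinite ((Fin m → ℤ) ⧸ N) := not_finite_iff_infinite.1 hfin
    simp

/-- The classes modulo `B ℤᵐ` of the vectors `A z`, `z ∈ ℤⁿ`. -/
abbrev classGroup (A : Matrix (Fin m) (Fin n) ℤ) (B : Matrix (Fin m) (Fin m) ℤ) :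
    Submodule ℤ ((Fin m → ℤ) ⧸ LinearMap.range B.mulVecLin) :=
  (LinearMap.range A.mulVecLin).map (LinearMap.range B.mulVecLin).mkQ

theorem range_submatrix_le (A : Matrix (Fin m) (Fin n) ℤ) (e : Fin m ↪ Fin n) :
    LinearMap.range (A.submatrix id e).mulVecLin ≤ LinearMap.range A.mulVecLin := by
  rintro _ ⟨z, rfl⟩
  refine ⟨fun j => ∑ i, if e i = j then z i else 0, ?_⟩
  ext k
  simp only [Matrix.mulVecLin_apply, Matrix.mulVec, dotProduct, Finset.mul_sum]
  rw [Finset.sum_comm]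
  simp

/-- Multiplicativity of the index along `Bℤᵐ ≤ Aℤⁿ ≤ ℤᵐ`: the total is `|det B|`, and the upper
factor is a positive multiple of `γ`. -/
theorem card_classGroup_mul_gcdMinor_le (A : Matrix (Fin m) (Fin n) ℤ) (e : Fin m ↪ Fin n)
    (he : (A.submatrix id e).det ≠ 0) :
    Finite (classGroup A (A.submatrix id e)) ∧
    0 < Nat.card (classGroup A (A.submatrix id e)) ∧
    Nat.card (classGroup A (A.submatrix id e)) * gcdMinor A ≤ (A.submatrix id e).det.natAbs := by
  have h1 := Submodule.card_quotient_mul_card_quotient (LinearMap.range A.mulVecLin) _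
    (range_submatrix_le A e)
  rw [card_quotient_range_eq_det _ he] at h1
  have hpos : 0 < (A.submatrix id e).det.natAbs := Int.natAbs_pos.2 he
  have h2 : 0 < Nat.card (classGroup A (A.submatrix id e)) :=
    Nat.pos_of_ne_zero fun h => by rw [h] at h1; omega
  have h3 : 0 < Nat.card ((Fin m → ℤ) ⧸ LinearMap.range A.mulVecLin) :=
    Nat.pos_of_ne_zero fun h => by rw [h] at h1; omega
  refine ⟨Nat.finite_of_card_ne_zero h2.ne', h2, ?_⟩
  rw [← h1]
  exact Nat.mul_le_mul_left _ (Nat.le_of_dvd h3 (gcdMinor_dvd_card_quotient A))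

end

/-! ### Strict bases, the group relaxation and the distance bound. -/

section

variable {m n : ℕ}

theorem sum_mul_extend {R : Type*} [NonUnitalNonAssocSemiring R] (e : Fin m ↪o Fin n)
    (f : Fin n → R) (x : Fin m → R) :
    ∑ j, f j * Function.extend e x 0 j = ∑ i, f (e i) * x i := by
  classical
  have h : ∑ j ∈ Finset.univ.map e.toEmbedding, f j * Function.extend e x 0 j =
      ∑ j, f j * Function.extend e x 0 j := by
    refine Finset.sum_subset (Finset.subset_univ _) fun j _ hj => ?_
    rw [Function.extend_apply' _ _ _ (by simpa using hj)]
    simp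
  rw [← h, Finset.sum_map]
  simp [e.injective.extend_apply]

theorem mulVec_extend {R : Type*} [NonUnitalNonAssocSemiring R] (A : Matrix (Fin m) (Fin n) R)
    (e : Fin m ↪o Fin n) (x : Fin m → R) :
    A.mulVec (Function.extend e x 0) = (A.submatrix id e).mulVec x := by
  ext k
  exact sum_mul_extend e (A k) x

/-- The columns `e` of `A` form a basis, with dual solution `u`, at which all reduced costs of
nonbasic variables are nonzero. -/
structure IsStrictBasis (A : Matrix (Fin m) (Fin n) ℤ) (c : Fin n → ℚ) (e : Fin m ↪o Fin n)
    (u : Fin m → ℝ) : Prop where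
  det_ne : (A.submatrix id e).det ≠ 0
  basic : ∀ i, (c (e i) : ℝ) = ∑ k, u k * (A k (e i) : ℝ)
  nonbasic : ∀ j ∉ Set.range e, (c j : ℝ) < ∑ k, u k * (A k j : ℝ)

/-- The negated reduced cost of the variable `j` with respect to the dual vector `u`. -/
def slack (A : Matrix (Fin m) (Fin n) ℤ) (c : Fin n → ℚ) (u : Fin m → ℝ) (j : Fin n) : ℝ :=
  ∑ k, u k * (A k j : ℝ) - c j

/-- On `A v = b` the objective is the constant `u·b` minus the slack cost, so both programs amount
to minimizing the slack cost. -/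
theorem objective_eq (A : Matrix (Fin m) (Fin n) ℤ) (c : Fin n → ℚ) (u : Fin m → ℝ)
    (v : Fin n → ℝ) :
    ∑ j, (c j : ℝ) * v j =
      ∑ k, u k * (A.map (Int.cast : ℤ → ℝ)).mulVec v k - ∑ j, slack A c u j * v j := by
  have h : ∑ k, u k * (A.map (Int.cast : ℤ → ℝ)).mulVec v k =
      ∑ j, (∑ k, u k * (A k j : ℝ)) * v j := by
    simp only [Matrix.mulVec, dotProduct, Finset.mul_sum, Finset.sum_mul, Matrix.map_apply]
    rw [Finset.sum_comm]
    simp [mul_assoc]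
  rw [h, ← Finset.sum_sub_distrib]
  exact Finset.sum_congr rfl fun j _ => by rw [slack]; ring

variable {A : Matrix (Fin m) (Fin n) ℤ} {c : Fin n → ℚ} {e : Fin m ↪o Fin n} {u : Fin m → ℝ}

theorem IsStrictBasis.slack_basic (h : IsStrictBasis A c e u) (i : Fin m) :
    slack A c u (e i) = 0 := by
  rw [slack, h.basic i, sub_self]

theorem IsStrictBasis.slack_pos (h : IsStrictBasis A c e u) {j : Fin n} (hj : j ∉ Set.range e) :
    0 < slack A c u j :=
  sub_pos.2 (h.nonbasic j hj)

theorem IsStrictBasis.slack_nonneg (h : IsStrictBasis A c e u) (j : Fin n) :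
    0 ≤ slack A c u j := by
  by_cases hj : j ∈ Set.range e
  · obtain ⟨i, rfl⟩ := hj
    exact (h.slack_basic i).ge
  · exact (h.slack_pos hj).le

theorem extend_nonneg {x : Fin m → ℝ} (hx : ∀ i, 0 ≤ x i) (j : Fin n) :
    0 ≤ Function.extend e x 0 j := by
  by_cases hj : j ∈ Set.range e
  · obtain ⟨i, rfl⟩ := hj
    rw [e.injective.extend_apply]; exact hx i
  · rw [Function.extend_apply' _ _ _ hj]; rfl

theorem IsStrictBasis.lpOptimal_extend (h : IsStrictBasis A c e u) {b : Fin m → ℤ}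
    {x : Fin m → ℝ} (hx : ∀ i, 0 ≤ x i)
    (hb : ((A.submatrix id e).map (Int.cast : ℤ → ℝ)).mulVec x = fun i => (b i : ℝ)) :
    LPOptimal A c b (Function.extend e x 0) := by
  have hfeas : (A.map (Int.cast : ℤ → ℝ)).mulVec (Function.extend e x 0) =
      fun i => (b i : ℝ) := by
    rw [mulVec_extend, ← hb, Matrix.submatrix_map]
  refine ⟨⟨hfeas, extend_nonneg hx⟩, fun y hy => ?_⟩
  rw [objective_eq A c u y, objective_eq A c u (Function.extend e x 0), hy.1, hfeas,
    sum_mul_extend]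
  have : 0 ≤ ∑ j, slack A c u j * y j :=
    Finset.sum_nonneg fun j _ => mul_nonneg (h.slack_nonneg j) (hy.2 j)
  simp only [h.slack_basic, zero_mul, Finset.sum_const_zero]
  linarith

theorem lpOpt_eq {b : Fin m → ℤ} (hunique : ∃! x, LPOptimal A c b x) {x : Fin n → ℝ}
    (hx : LPOptimal A c b x) : lpOpt A c b = x :=
  hunique.unique (Classical.epsilon_spec ⟨x, hx⟩) hx

/-- Replacing a basis column by column `j` yields another maximal minor of `A`, or zero if `j` is
already present. -/
theorem abs_cramer_col_le (A : Matrix (Fin m) (Fin n) ℤ) (e : Fin m ↪o Fin n) (j : Fin n)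
    (i : Fin m) :
    |((A.submatrix id e).map (Int.cast : ℤ → ℝ)).cramer (fun k => (A k j : ℝ)) i| ≤
      maxMinor A := by
  have h : (((A.submatrix id e).map (Int.cast : ℤ → ℝ)).updateCol i (fun k => (A k j : ℝ))) =
      (A.submatrix id (Function.update e i j)).map (Int.cast : ℤ → ℝ) := by
    ext k l
    by_cases hl : l = i
    · subst hl; simp
    · simp [hl]
  have hdet : ((A.submatrix id (Function.update e i j)).map (Int.cast : ℤ → ℝ)).det =
      ((A.submatrix id (Function.update e i j)).det : ℝ) := (Int.cast_det _).symm
  rw [Matrix.cramer_apply, h, hdet, ← Int.cast_abs, Int.abs_eq_natAbs, Int.cast_natCast,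
    Nat.cast_le]
  by_cases hinj : Function.Injective (Function.update e i j)
  · exact natAbs_minor_le_maxMinor A ⟨_, hinj⟩
  · obtain ⟨p, q, hpq, hne⟩ := Function.not_injective_iff.1 hinj
    rw [Matrix.det_zero_of_column_eq hne fun k => by simp only [Matrix.submatrix_apply, hpq]]
    simp

theorem abs_le_of_mulVec_eq (hdet : (A.submatrix id e).det ≠ 0) {v : Fin m → ℝ} {y : Fin n → ℝ}
    (hy : ∀ j, 0 ≤ y j)
    (hv : ((A.submatrix id e).map (Int.cast : ℤ → ℝ)).mulVec v =
      (A.map (Int.cast : ℤ → ℝ)).mulVec y) (i : Fin m) :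
    |v i| ≤ maxMinor A / ((A.submatrix id e).det.natAbs : ℝ) * ∑ j, y j := by
  set B := (A.submatrix id e).map (Int.cast : ℤ → ℝ) with hBdef
  have hd : B.det = ((A.submatrix id e).det : ℝ) := (Int.cast_det _).symm
  have h1 : B.det * v i = ∑ j, y j * B.cramer (fun k => (A k j : ℝ)) i := by
    have h2 : B.cramer (B.mulVec v) = B.det • v := by
      rw [Matrix.cramer_eq_adjugate_mulVec, Matrix.mulVec_mulVec, Matrix.adjugate_mul,
        Matrix.smul_mulVec, Matrix.one_mulVec]
    have h3 : (A.map (Int.cast : ℤ → ℝ)).mulVec y = ∑ j, y j • fun k => (A k j : ℝ) := by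
      ext k
      simp [Matrix.mulVec, dotProduct, mul_comm, Finset.sum_apply]
    rw [hv, h3, map_sum] at h2
    have h4 := congrFun h2 i
    simp only [map_smul, Finset.sum_apply, Pi.smul_apply, smul_eq_mul] at h4
    exact h4.symm
  have hpos : (0 : ℝ) < ((A.submatrix id e).det.natAbs : ℝ) :=
    Nat.cast_pos.2 (Int.natAbs_pos.2 hdet)
  have habs : |B.det| = ((A.submatrix id e).det.natAbs : ℝ) := by
    rw [hd, ← Int.cast_abs, Int.abs_eq_natAbs, Int.cast_natCast]
  rw [div_mul_eq_mul_div, le_div_iff₀ hpos, ← habs, mul_comm, ← abs_mul, h1, Finset.mul_sum]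
  refine (Finset.abs_sum_le_sum_abs _ _).trans (Finset.sum_le_sum fun j _ => ?_)
  rw [abs_mul, abs_of_nonneg (hy j), mul_comm]
  exact mul_le_mul_of_nonneg_right (abs_cramer_col_le A e j i) (hy j)

/-- `y` is an optimal solution of the group relaxation with respect to the basis `e`. -/
structure IsGroupOptimal (A : Matrix (Fin m) (Fin n) ℤ) (c : Fin n → ℚ) (e : Fin m ↪o Fin n)
    (u : Fin m → ℝ) (y : Fin n → ℕ) : Prop where
  basic : ∀ i, y (e i) = 0
  le : ∀ w : Fin n → ℕ, A.mulVec (fun j => (w j : ℤ)) - A.mulVec (fun j => (y j : ℤ)) ∈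
    LinearMap.range (A.submatrix id e).mulVecLin →
    ∑ j, slack A c u j * (y j : ℝ) ≤ ∑ j, slack A c u j * (w j : ℝ)

theorem map_mulVec_cast {l : ℕ} (A : Matrix (Fin m) (Fin l) ℤ) (w : Fin l → ℤ) :
    (A.map (Int.cast : ℤ → ℝ)).mulVec (fun j => (w j : ℝ)) = fun k => (A.mulVec w k : ℝ) := by
  ext k
  simp [Matrix.mulVec, dotProduct]

/-- Any feasible `w` lies in the class of `y`, so its slack cost is at least that of `y`; adding `z`
on the basic columns costs nothing. -/
theorem IsStrictBasis.ipOptimal (h : IsStrictBasis A c e u) {y : Fin n → ℕ}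
    (hy : IsGroupOptimal A c e u y) {z : Fin m → ℤ} (hz : ∀ i, 0 ≤ z i) {b : Fin m → ℤ}
    (hb : b = A.mulVec (fun j => (y j : ℤ)) + (A.submatrix id e).mulVec z) :
    IPOptimal A c b (fun j => (y j : ℤ) + Function.extend e z 0 j) := by
  have hA : A.mulVec (fun j => (y j : ℤ) + Function.extend e z 0 j) = b := by
    rw [hb, ← mulVec_extend, ← Matrix.mulVec_add]
    rfl
  refine ⟨⟨hA, fun j => ?_⟩, fun w hw => ?_⟩
  · by_cases hj : j ∈ Set.range e
    · obtain ⟨i, rfl⟩ := hj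
      simp only [e.injective.extend_apply]
      have := hz i
      positivity
    · simp [Function.extend_apply' _ _ _ hj]
  · have hcast : ∑ j, (c j : ℝ) * (w j : ℝ) ≤
        ∑ j, (c j : ℝ) * (((y j : ℤ) + Function.extend e z 0 j : ℤ) : ℝ) := by
      rw [objective_eq A c u, objective_eq A c u, map_mulVec_cast, map_mulVec_cast, hw.1, hA]
      have h0 : ∑ j, slack A c u j * (((y j : ℤ) + Function.extend e z 0 j : ℤ) : ℝ) =
          ∑ j, slack A c u j * (y j : ℝ) := by
        refine Finset.sum_congr rfl fun j _ => ?_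
        by_cases hj : j ∈ Set.range e
        · obtain ⟨i, rfl⟩ := hj
          rw [h.slack_basic]; simp
        · rw [Function.extend_apply' _ _ _ hj]; simp
      have hle := hy.le (fun j => (w j).toNat) (by
        have : (fun j => ((w j).toNat : ℤ)) = w := funext fun j => Int.toNat_of_nonneg (hw.2 j)
        rw [this, hw.1, hb, add_sub_cancel_left]
        exact ⟨z, rfl⟩)
      have hw' : ∀ j, (((w j).toNat : ℕ) : ℝ) = (w j : ℝ) := fun j => by
        exact_mod_cast congrArg (Int.cast : ℤ → ℝ) (Int.toNat_of_nonneg (hw.2 j))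
      simp only [hw'] at hle
      rw [h0]
      linarith
    exact_mod_cast hcast

theorem IsStrictBasis.abs_lpOpt_sub_le (h : IsStrictBasis A c e u) {y : Fin n → ℕ}
    (hy : ∀ i, y (e i) = 0) {z : Fin m → ℤ} {b : Fin m → ℤ}
    (hb : b = A.mulVec (fun j => (y j : ℤ)) + (A.submatrix id e).mulVec z)
    {x : Fin m → ℝ}
    (hx : ((A.submatrix id e).map (Int.cast : ℤ → ℝ)).mulVec x = fun i => (b i : ℝ)) :
    (∀ i, |Function.extend e x 0 (e i) - (((y (e i) : ℤ) + Function.extend e z 0 (e i) : ℤ) : ℝ)| ≤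
      maxMinor A / ((A.submatrix id e).det.natAbs : ℝ) * ∑ j, (y j : ℝ)) ∧
    (∀ j ∉ Set.range e,
      |Function.extend e x 0 j - (((y j : ℤ) + Function.extend e z 0 j : ℤ) : ℝ)| = y j) := by
  constructor
  · intro i
    rw [e.injective.extend_apply, e.injective.extend_apply, hy i]
    have hv : ((A.submatrix id e).map (Int.cast : ℤ → ℝ)).mulVec (x - fun i => (z i : ℝ)) =
        (A.map (Int.cast : ℤ → ℝ)).mulVec (fun j => (y j : ℝ)) := by
      have := map_mulVec_cast A (fun j => (y j : ℤ))
      simp only [Int.cast_natCast] at this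
      rw [Matrix.mulVec_sub, hx, map_mulVec_cast, this, hb]
      ext k
      simp
    simpa using abs_le_of_mulVec_eq h.det_ne (fun j => Nat.cast_nonneg (y j)) hv i
  · intro j hj
    rw [Function.extend_apply' _ _ _ hj, Function.extend_apply' _ _ _ hj]
    simp

theorem IsStrictBasis.dist_le (h : IsStrictBasis A c e u) {y : Fin n → ℕ}
    (hy : IsGroupOptimal A c e u y) {z : Fin m → ℤ} (hz : ∀ i, 0 ≤ z i) {b : Fin m → ℤ}
    (hb : b = A.mulVec (fun j => (y j : ℤ)) + (A.submatrix id e).mulVec z)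
    {x : Fin m → ℝ} (hx0 : ∀ i, 0 ≤ x i)
    (hx : ((A.submatrix id e).map (Int.cast : ℤ → ℝ)).mulVec x = fun i => (b i : ℝ))
    (hunique : (∃ z, IPFeasible A b z) → ∃! x, LPOptimal A c b x) {κ r : ℝ}
    (hκ : maxMinor A / ((A.submatrix id e).det.natAbs : ℝ) * ∑ j, (y j : ℝ) ≤ κ)
    (hr : ∑ j, (y j : ℝ) ≤ r) :
    distOne A c b ≤ ENNReal.ofReal (m * κ + r) ∧
      (r ≤ κ → distSup A c b ≤ ENNReal.ofReal κ) := by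
  have hopt := h.ipOptimal hy hz hb
  have hlp := lpOpt_eq (hunique ⟨_, hopt.1⟩) (h.lpOptimal_extend hx0 hx)
  obtain ⟨h1, h2⟩ := h.abs_lpOpt_sub_le hy.basic hb hx
  constructor
  · refine (iInf₂_le _ hopt).trans (ENNReal.ofReal_le_ofReal ?_)
    rw [hlp]
    -- Each of the `m` basic coordinates contributes at most `κ`, and the nonbasic ones together at
    -- most `r`.
    have hle : ∀ j, |Function.extend e x 0 j - (((y j : ℤ) + Function.extend e z 0 j : ℤ) : ℝ)| ≤
        1 * Function.extend e (fun _ => κ) 0 j + y j := by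
      intro j
      by_cases hj : j ∈ Set.range e
      · obtain ⟨i, rfl⟩ := hj
        rw [e.injective.extend_apply (fun _ => κ)]
        have := h1 i
        rw [hy.basic] at this ⊢
        push_cast at this ⊢
        linarith
      · rw [h2 j hj, Function.extend_apply' (fun _ => κ) _ _ hj]
        simp
    refine (Finset.sum_le_sum fun j _ => hle j).trans ?_
    rw [Finset.sum_add_distrib, sum_mul_extend]
    simp only [one_mul, Finset.sum_const, Finset.card_univ, Fintype.card_fin, nsmul_eq_mul]
    linarith
  · intro hrκ
    refine (iInf₂_le _ hopt).trans (ENNReal.ofReal_le_ofReal ?_)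
    rw [hlp]
    have h0 : 0 ≤ ∑ j, (y j : ℝ) := Finset.sum_nonneg fun j _ => Nat.cast_nonneg _
    refine (pi_norm_le_iff_of_nonneg (by linarith)).2 fun j => ?_
    rw [Real.norm_eq_abs]
    by_cases hj : j ∈ Set.range e
    · obtain ⟨i, rfl⟩ := hj
      exact (h1 i).trans hκ
    · rw [h2 j hj]
      have := Finset.single_le_sum (f := fun j => (y j : ℝ)) (fun j _ => Nat.cast_nonneg _)
        (Finset.mem_univ j)
      linarith

end

/-! ### Short optimal solutions of the group relaxation. -/

section

variable {m n : ℕ}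

theorem exists_le_sum_eq (y : Fin n → ℕ) {k : ℕ} (hk : k ≤ ∑ j, y j) :
    ∃ y' ≤ y, ∑ j, y' j = k := by
  induction k with
  | zero => exact ⟨0, fun j => Nat.zero_le _, by simp⟩
  | succ k ih =>
    obtain ⟨y', hle, hsum⟩ := ih (by omega)
    have : ∃ j, y' j < y j := by
      by_contra! h
      have := Finset.sum_le_sum fun j (_ : j ∈ Finset.univ) => h j
      omega
    obtain ⟨j, hj⟩ := this
    refine ⟨y' + Pi.single j 1, fun i => ?_, ?_⟩
    · by_cases hi : i = j
      · subst hi; simpa using hj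
      · simpa [hi] using hle i
    · simp [Finset.sum_add_distrib, hsum]

theorem exists_chain (k : ℕ) (y : Fin n → ℕ) (hk : ∑ j, y j = k) :
    ∃ Y : Finset (Fin n → ℕ), Y.card = k + 1 ∧ (∀ v ∈ Y, v ≤ y) ∧
      IsChain (· ≤ ·) (Y : Set (Fin n → ℕ)) := by
  induction k generalizing y with
  | zero => exact ⟨{y}, by simp⟩
  | succ k ih =>
    obtain ⟨y', hle, hsum⟩ := exists_le_sum_eq y (k := k) (by omega)
    obtain ⟨Y, hcard, hY, hchain⟩ := ih y' hsum
    have hnot : y ∉ Y := fun hy => by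
      have := Finset.sum_le_sum fun j (_ : j ∈ Finset.univ) => hY y hy j
      omega
    refine ⟨insert y Y, by rw [Finset.card_insert_of_notMem hnot, hcard], fun v hv => ?_, ?_⟩
    · rcases Finset.mem_insert.1 hv with rfl | hv
      · exact le_rfl
      · exact (hY v hv).trans hle
    · rw [Finset.coe_insert]
      exact hchain.insert fun v hv _ => Or.inr ((hY v hv).trans hle)

variable {A : Matrix (Fin m) (Fin n) ℤ} {c : Fin n → ℚ} {e : Fin m ↪o Fin n} {u : Fin m → ℝ}

/-- The class of `A w` modulo the lattice spanned by the basis `e`. -/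
def cls (A : Matrix (Fin m) (Fin n) ℤ) (e : Fin m ↪o Fin n) (w : Fin n → ℕ) :
    (Fin m → ℤ) ⧸ LinearMap.range (A.submatrix id e).mulVecLin :=
  (LinearMap.range (A.submatrix id e).mulVecLin).mkQ (A.mulVec fun j => (w j : ℤ))

theorem cls_eq_iff {w y : Fin n → ℕ} : cls A e w = cls A e y ↔
    A.mulVec (fun j => (w j : ℤ)) - A.mulVec (fun j => (y j : ℤ)) ∈
      LinearMap.range (A.submatrix id e).mulVecLin := by
  simp only [cls, Submodule.mkQ_apply]
  exact Submodule.Quotient.eq _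

theorem cls_add (w y : Fin n → ℕ) : cls A e (w + y) = cls A e w + cls A e y := by
  rw [cls, cls, cls, ← map_add, ← Matrix.mulVec_add]
  congr 2

theorem cls_mem (w : Fin n → ℕ) : cls A e w ∈ classGroup A (A.submatrix id e) :=
  Submodule.mem_map_of_mem ⟨_, rfl⟩

theorem exists_cls_eq (hdet : (A.submatrix id e).det ≠ 0)
    {g : (Fin m → ℤ) ⧸ LinearMap.range (A.submatrix id e).mulVecLin}
    (hg : g ∈ classGroup A (A.submatrix id e)) : ∃ w, cls A e w = g := by
  obtain ⟨_, ⟨z, rfl⟩, rfl⟩ := hg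
  set d := (A.submatrix id e).det
  have hd : 1 ≤ d * d := by
    have := mul_self_pos.2 hdet
    omega
  -- Since `d • v = B (adj B) v`, adding a multiple of `d` keeps the class; `d * d ≥ 1` makes the
  -- entries nonnegative whatever the sign of `d`.
  refine ⟨fun j => (z j + d * d * |z j|).toNat, ?_⟩
  have hw : (fun j => (((z j + d * d * |z j|).toNat : ℕ) : ℤ)) =
      z + (d * d) • fun j => |z j| := by
    ext j
    simp only [Pi.add_apply, Pi.smul_apply, smul_eq_mul]
    refine Int.toNat_of_nonneg ?_
    nlinarith [neg_abs_le (z j), abs_nonneg (z j)]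
  rw [cls, hw, Submodule.mkQ_apply, Submodule.mkQ_apply]
  refine (Submodule.Quotient.eq _).2 ⟨d • (A.submatrix id e).adjugate.mulVec
    (A.mulVec fun j => |z j|), ?_⟩
  rw [Matrix.mulVecLin_apply, Matrix.mulVecLin_apply, Matrix.mulVec_smul, Matrix.mulVec_mulVec,
    Matrix.mul_adjugate, Matrix.smul_mulVec, Matrix.one_mulVec, Matrix.mulVec_add,
    Matrix.mulVec_smul, add_sub_cancel_left, smul_smul]

/-- By Dickson's lemma the monotone slack cost has well-founded image on a class, so a minimum
exists although the costs are real. Erasing basic coordinates then changes neither class nor cost.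
-/
theorem IsStrictBasis.exists_isGroupOptimal (h : IsStrictBasis A c e u)
    {g : (Fin m → ℤ) ⧸ LinearMap.range (A.submatrix id e).mulVecLin}
    (hg : g ∈ classGroup A (A.submatrix id e)) : ∃ y, IsGroupOptimal A c e u y ∧ cls A e y = g := by
  classical
  set S : Set (Fin n → ℕ) := {w | cls A e w = g}
  have hne : S.Nonempty := exists_cls_eq h.det_ne hg
  set f : (Fin n → ℕ) → ℝ := fun w => ∑ j, slack A c u j * (w j : ℝ)
  have hf : Monotone f := fun v w hvw => Finset.sum_le_sum fun j _ =>
    mul_le_mul_of_nonneg_left (Nat.cast_le.2 (hvw j)) (h.slack_nonneg j)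
  have hwf : (f '' S).IsWF := ((Set.isPWO_of_wellQuasiOrderedLE S).image_of_monotone hf).isWF
  obtain ⟨w, hwS, hw⟩ := hwf.min_mem (hne.image f)
  have hmin : ∀ v ∈ S, f w ≤ f v := fun v hv => hw ▸ hwf.min_le _ ⟨v, hv, rfl⟩
  set y : Fin n → ℕ := fun j => if j ∈ Set.range e then 0 else w j with hy
  have hwy : w = y + Function.extend e (fun i => w (e i)) 0 := by
    ext j
    by_cases hj : j ∈ Set.range e
    · obtain ⟨i, rfl⟩ := hj
      simp [hy, e.injective.extend_apply]
    · simp only [Pi.add_apply, Function.extend_apply' _ _ _ hj]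
      exact (if_neg hj).symm
  have hcls : cls A e y = g := by
    rw [← show cls A e w = g from hwS, hwy, cls_add, left_eq_add, cls, Submodule.mkQ_apply]
    refine (Submodule.Quotient.mk_eq_zero _).2 ⟨fun i => (w (e i) : ℤ), ?_⟩
    have hext : (fun j => ((Function.extend e (fun i => w (e i)) 0 j : ℕ) : ℤ)) =
        Function.extend e (fun i => (w (e i) : ℤ)) 0 := by
      ext j
      by_cases hj : j ∈ Set.range e
      · obtain ⟨i, rfl⟩ := hj
        rw [e.injective.extend_apply, e.injective.extend_apply]
      · rw [Function.extend_apply' _ _ _ hj, Function.extend_apply' _ _ _ hj]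
        simp
    rw [hext, mulVec_extend, Matrix.mulVecLin_apply]
  have hyw : y ≤ w := fun j => by
    simp only [hy]; split_ifs <;> simp
  refine ⟨y, ⟨fun i => by simp [hy], fun v hv => ?_⟩, hcls⟩
  exact (hf hyw).trans (hmin v ((cls_eq_iff.2 hv).trans hcls))

/-- Exchange: a cheaper `w` in the class of `y'` would make `w + (y - y')` cheaper than `y` in the
class of `y`. -/
theorem IsGroupOptimal.of_le {y y' : Fin n → ℕ} (hy : IsGroupOptimal A c e u y) (hle : y' ≤ y) :
    IsGroupOptimal A c e u y' := by
  refine ⟨fun i => Nat.le_zero.1 ((hle _).trans (hy.basic i).le), fun w hw => ?_⟩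
  have hyy : y = y' + (y - y') := (add_tsub_cancel_of_le hle).symm
  have h1 := hy.le (w + (y - y')) (cls_eq_iff.1 (by
    conv_rhs => rw [hyy]
    rw [cls_add, cls_add, cls_eq_iff.2 hw]))
  have h2 : ∑ j, slack A c u j * (y j : ℝ) = ∑ j, slack A c u j * (y' j : ℝ) +
      ∑ j, slack A c u j * ((y - y') j : ℝ) := by
    conv_lhs => rw [hyy]
    simp only [Pi.add_apply, Nat.cast_add, mul_add, Finset.sum_add_distrib]
  simp only [Pi.add_apply, Nat.cast_add, mul_add, Finset.sum_add_distrib] at h1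
  linarith

/-- Dropping any part of `y` strictly lowers the cost, because `y` lives on columns of positive
slack. -/
theorem IsStrictBasis.eq_of_le_of_cls_eq (h : IsStrictBasis A c e u) {y y' : Fin n → ℕ}
    (hy : IsGroupOptimal A c e u y) (hle : y' ≤ y)
    (hcls : cls A e y' = cls A e y) : y' = y := by
  by_contra hne
  have h1 := hy.le y' (cls_eq_iff.1 hcls)
  obtain ⟨j, hj⟩ : ∃ j, y' j ≠ y j := Function.ne_iff.1 hne
  have hlt : y' j < y j := lt_of_le_of_ne (hle j) hj
  have hj' : j ∉ Set.range e := by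
    rintro ⟨i, rfl⟩
    have := hy.basic i
    omega
  refine absurd h1 (not_le.2 (Finset.sum_lt_sum (fun i _ => ?_) ⟨j, Finset.mem_univ _, ?_⟩))
  · exact mul_le_mul_of_nonneg_left (Nat.cast_le.2 (hle i)) (h.slack_nonneg i)
  · exact mul_lt_mul_of_pos_left (Nat.cast_lt.2 hlt) (h.slack_pos hj')

/-- Either every class has an optimal solution of length at most `k`, and any `k + 1` classes do. Or
some optimal `y` is longer; a chain of `k + 1` vectors below it, of lengths `0` to `k`, consists of
optimal solutions, and comparable optimal solutions have distinct classes. -/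
theorem IsStrictBasis.exists_finset_isGroupOptimal (h : IsStrictBasis A c e u) {k : ℕ}
    (hk : k + 1 ≤ Nat.card (classGroup A (A.submatrix id e))) :
    ∃ Y : Finset (Fin n → ℕ), Y.card = k + 1 ∧
      (∀ y ∈ Y, IsGroupOptimal A c e u y ∧ ∑ j, y j ≤ k) ∧ Set.InjOn (cls A e) Y := by
  classical
  have hfin := (card_classGroup_mul_gcdMinor_le A e.toEmbedding h.det_ne).1
  change Finite (classGroup A (A.submatrix id e)) at hfin
  have := Fintype.ofFinite (classGroup A (A.submatrix id e))
  by_cases hall : ∀ g : classGroup A (A.submatrix id e), ∃ y, IsGroupOptimal A c e u y ∧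
      cls A e y = g ∧ ∑ j, y j ≤ k
  · choose f hf1 hf2 hf3 using hall
    have hinj : Function.Injective f := fun g g' hgg => by
      rw [← Subtype.coe_inj, ← hf2, ← hf2, hgg]
    obtain ⟨Y, hY, hcard⟩ := Finset.exists_subset_card_eq (s := Finset.univ.image f) (n := k + 1)
      (by rwa [Finset.card_image_of_injective _ hinj, Finset.card_univ, ← Nat.card_eq_fintype_card])
    refine ⟨Y, hcard, fun y hy => ?_, fun y hy y' hy' hyy => ?_⟩
    · obtain ⟨g, -, rfl⟩ := Finset.mem_image.1 (hY hy)
      exact ⟨hf1 g, hf3 g⟩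
    · obtain ⟨g, -, rfl⟩ := Finset.mem_image.1 (hY hy)
      obtain ⟨g', -, rfl⟩ := Finset.mem_image.1 (hY hy')
      rw [hf2, hf2, Subtype.coe_inj] at hyy
      rw [hyy]
  · push Not at hall
    obtain ⟨g, hg⟩ := hall
    obtain ⟨y, hy, hyg⟩ := h.exists_isGroupOptimal g.2
    obtain ⟨y', hle, hsum⟩ := exists_le_sum_eq y (hg y hy hyg).le
    obtain ⟨Y, hcard, hY, hchain⟩ := exists_chain k y' hsum
    have hopt : ∀ v ∈ Y, IsGroupOptimal A c e u v := fun v hv => hy.of_le ((hY v hv).trans hle)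
    refine ⟨Y, hcard, fun v hv => ⟨hopt v hv, ?_⟩, fun v hv w hw hvw => ?_⟩
    · rw [← hsum]
      exact Finset.sum_le_sum fun j _ => hY v hv j
    · rcases hchain.total hv hw with hle | hle
      · exact h.eq_of_le_of_cls_eq (hopt w hw) hle hvw
      · exact (h.eq_of_le_of_cls_eq (hopt v hv) hle hvw.symm).symm

end

/-! ### Counting right-hand sides in one cone. -/

section

variable {m n : ℕ}

/-- The number of points of norm at most `t` in `S`. -/
noncomputable def cnt (S : Set (Fin m → ℤ)) (t : ℕ) : ℕ := Set.ncard {b | b ∈ S ∧ ‖b‖ ≤ (t : ℝ)}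

theorem setOf_norm_le_eq (t : ℕ) : {b : Fin m → ℤ | ‖b‖ ≤ (t : ℝ)} =
    (Fintype.piFinset fun _ : Fin m => Finset.Icc (-(t : ℤ)) t : Finset (Fin m → ℤ)) := by
  ext b
  rw [Set.mem_ofPred_eq, Finset.mem_coe, Fintype.mem_piFinset,
    pi_norm_le_iff_of_nonneg (Nat.cast_nonneg t)]
  refine forall_congr' fun i => ?_
  rw [Int.norm_eq_abs, Finset.mem_Icc, ← abs_le]
  exact_mod_cast Iff.rfl

theorem finite_norm_le (t : ℕ) : {b : Fin m → ℤ | ‖b‖ ≤ (t : ℝ)}.Finite := by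
  rw [setOf_norm_le_eq]
  exact Finset.finite_toSet _

theorem finite_cnt (S : Set (Fin m → ℤ)) (t : ℕ) : {b | b ∈ S ∧ ‖b‖ ≤ (t : ℝ)}.Finite :=
  (finite_norm_le t).subset fun _ h => h.2

theorem ncard_norm_le (t : ℕ) : {b : Fin m → ℤ | ‖b‖ ≤ (t : ℝ)}.ncard = (2 * t + 1) ^ m := by
  rw [setOf_norm_le_eq, Set.ncard_coe_finset, Fintype.card_piFinset]
  simp only [Int.card_Icc, Finset.prod_const, Finset.card_univ, Fintype.card_fin]
  congr 1
  omega

theorem cnt_mono {S T : Set (Fin m → ℤ)} (h : S ⊆ T) (t : ℕ) : cnt S t ≤ cnt T t :=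
  Set.ncard_le_ncard (fun _ hb => ⟨h hb.1, hb.2⟩) (finite_cnt T t)

theorem cnt_add_le (S : Set (Fin m → ℤ)) (t s : ℕ) :
    cnt S (t + s) + (2 * t + 1) ^ m ≤ cnt S t + (2 * (t + s) + 1) ^ m := by
  rw [← ncard_norm_le, ← ncard_norm_le]
  have hsub : {b : Fin m → ℤ | ‖b‖ ≤ (t : ℝ)} ⊆ {b | ‖b‖ ≤ ((t + s : ℕ) : ℝ)} := fun b hb =>
    le_trans (show ‖b‖ ≤ (t : ℝ) from hb) (by push_cast; linarith [Nat.cast_nonneg (α := ℝ) s])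
  have h1 := Set.ncard_sdiff_add_ncard_of_subset hsub (finite_norm_le _)
  have h2 : cnt S (t + s) ≤ cnt S t +
      ({b : Fin m → ℤ | ‖b‖ ≤ ((t + s : ℕ) : ℝ)} \ {b | ‖b‖ ≤ (t : ℝ)}).ncard := by
    refine (Set.ncard_le_ncard (fun b hb => ?_)
      ((finite_cnt S t).union ((finite_norm_le _).subset Set.sdiff_subset))).trans
      (Set.ncard_union_le _ _)
    by_cases hbt : ‖b‖ ≤ (t : ℝ)
    · exact Or.inl ⟨hb.1, hbt⟩
    · exact Or.inr ⟨hb.2, hbt⟩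
  omega

/-- The right-hand sides in the lattice `A ℤⁿ` that lie in the cone spanned by the columns `e`. -/
def coneSet (A : Matrix (Fin m) (Fin n) ℤ) (e : Fin m ↪o Fin n) : Set (Fin m → ℤ) :=
  {b | b ∈ LinearMap.range A.mulVecLin ∧ ∃ x : Fin m → ℝ, (∀ i, 0 ≤ x i) ∧
    ((A.submatrix id e).map (Int.cast : ℤ → ℝ)).mulVec x = fun i => (b i : ℝ)}

/-- The right-hand sides in the interior of the cone spanned by the columns `e` that are
nonnegative integer combinations of these columns, up to some `A y` with `y ∈ Y`. -/
def goodSet (A : Matrix (Fin m) (Fin n) ℤ) (e : Fin m ↪o Fin n) (Y : Finset (Fin n → ℕ)) :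
    Set (Fin m → ℤ) :=
  {b | (∃ y ∈ Y, ∃ z : Fin m → ℤ, (∀ i, 0 ≤ z i) ∧
    b = A.mulVec (fun j => (y j : ℤ)) + (A.submatrix id e).mulVec z) ∧
    ∃ x : Fin m → ℝ, (∀ i, 0 < x i) ∧
    ((A.submatrix id e).map (Int.cast : ℤ → ℝ)).mulVec x = fun i => (b i : ℝ)}

variable {A : Matrix (Fin m) (Fin n) ℤ} {e : Fin m ↪o Fin n}

theorem det_map_ne (hdet : (A.submatrix id e).det ≠ 0) :
    ((A.submatrix id e).map (Int.cast : ℤ → ℝ)).det ≠ 0 := by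
  have : ((A.submatrix id e).map (Int.cast : ℤ → ℝ)).det = ((A.submatrix id e).det : ℝ) :=
    (Int.cast_det _).symm
  rw [this]
  exact_mod_cast hdet

theorem exists_mulVec_eq (hdet : (A.submatrix id e).det ≠ 0) (b : Fin m → ℝ) :
    ∃ x, ((A.submatrix id e).map (Int.cast : ℤ → ℝ)).mulVec x = b := by
  refine ⟨((A.submatrix id e).map (Int.cast : ℤ → ℝ))⁻¹.mulVec b, ?_⟩
  rw [Matrix.mulVec_mulVec, Matrix.mul_nonsing_inv _ (isUnit_iff_ne_zero.2 (det_map_ne hdet)),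
    Matrix.one_mulVec]

theorem mulVec_map_injective (hdet : (A.submatrix id e).det ≠ 0) {x x' : Fin m → ℝ}
    (h : ((A.submatrix id e).map (Int.cast : ℤ → ℝ)).mulVec x =
      ((A.submatrix id e).map (Int.cast : ℤ → ℝ)).mulVec x') : x = x' := by
  rw [← sub_eq_zero] at h ⊢
  rw [← Matrix.mulVec_sub] at h
  exact Matrix.eq_zero_of_mulVec_eq_zero (det_map_ne hdet) h

/-- Every class has a representative far inside the cone spanned by the columns `e`. -/
theorem exists_deep_representatives (hdet : (A.submatrix id e).det ≠ 0)
    (Y : Finset (Fin n → ℕ)) :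
    ∃ v : classGroup A (A.submatrix id e) → (Fin m → ℤ),
      (∀ g, (LinearMap.range (A.submatrix id e).mulVecLin).mkQ (v g) = g) ∧
      ∀ g, ∃ p : Fin m → ℝ,
        ((A.submatrix id e).map (Int.cast : ℤ → ℝ)).mulVec p = (fun i => (v g i : ℝ)) ∧
        (∀ i, 0 < p i) ∧
        ∀ y ∈ Y, ∀ q : Fin m → ℝ, ((A.submatrix id e).map (Int.cast : ℤ → ℝ)).mulVec q =
          (fun i => (A.mulVec (fun j => (y j : ℤ)) i : ℝ)) → ∀ i, q i ≤ p i := by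
  have hfin := (card_classGroup_mul_gcdMinor_le A e.toEmbedding hdet).1
  change Finite (classGroup A (A.submatrix id e)) at hfin
  have := Fintype.ofFinite (classGroup A (A.submatrix id e))
  choose v₀ hv₀ using fun g : classGroup A (A.submatrix id e) =>
    Submodule.mkQ_surjective (LinearMap.range (A.submatrix id e).mulVecLin) g
  choose p hp using fun g => exists_mulVec_eq hdet (fun i => (v₀ g i : ℝ))
  choose q hq using fun y : Fin n → ℕ =>
    exists_mulVec_eq hdet (fun i => (A.mulVec (fun j => (y j : ℤ)) i : ℝ))
  obtain ⟨N, hN⟩ := exists_nat_gt (∑ g, ∑ i, |p g i| + ∑ y ∈ Y, ∑ i, |q y i|)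
  have hpN : ∀ g i, |p g i| ≤ ∑ g, ∑ i, |p g i| := fun g i =>
    (Finset.single_le_sum (f := fun i => |p g i|) (fun _ _ => abs_nonneg _)
      (Finset.mem_univ i)).trans (Finset.single_le_sum (f := fun g => ∑ i, |p g i|)
      (fun _ _ => Finset.sum_nonneg fun _ _ => abs_nonneg _) (Finset.mem_univ g))
  have hqN : ∀ y ∈ Y, ∀ i, |q y i| ≤ ∑ y ∈ Y, ∑ i, |q y i| := fun y hy i =>
    (Finset.single_le_sum (f := fun i => |q y i|) (fun _ _ => abs_nonneg _)
      (Finset.mem_univ i)).trans (Finset.single_le_sum (f := fun y => ∑ i, |q y i|)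
      (fun _ _ => Finset.sum_nonneg fun _ _ => abs_nonneg _) hy)
  have hq0 : 0 ≤ ∑ y ∈ Y, ∑ i, |q y i| :=
    Finset.sum_nonneg fun _ _ => Finset.sum_nonneg fun _ _ => abs_nonneg _
  -- Shifting by `N` times the sum of the basis columns keeps the class and adds `N` to every cone
  -- coordinate.
  refine ⟨fun g => v₀ g + (A.submatrix id e).mulVec fun _ => (N : ℤ), fun g => ?_, fun g => ?_⟩
  · rw [map_add, hv₀, add_eq_left, Submodule.mkQ_apply]
    exact (Submodule.Quotient.mk_eq_zero _).2 ⟨_, rfl⟩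
  · refine ⟨p g + fun _ => (N : ℝ), ?_, fun i => ?_, fun y hy q' hq' i => ?_⟩
    · have := map_mulVec_cast (A.submatrix id e) (fun _ => (N : ℤ))
      simp only [Int.cast_natCast] at this
      rw [Matrix.mulVec_add, hp, this]
      ext i
      simp
    · have := hpN g i
      have := neg_abs_le (p g i)
      simp only [Pi.add_apply]
      linarith
    · have hqq : q' = q y := mulVec_map_injective hdet (hq'.trans (hq y).symm)
      have := hpN g i
      have := neg_abs_le (p g i)
      have := hqN y hy i
      have := le_abs_self (q y i)
      rw [hqq]
      simp only [Pi.add_apply]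
      linarith

/-- Equidistribution of the classes without volumes: `(b, y) ↦ (b + v, [b])`, where `v` is the deep
representative of `[A y] - [b]`, is injective. The class of `b + v` reveals `y`; with `[b]` this
reveals `v`, hence `b`. The finitely many shifts `v` enlarge the box by a constant `s`. -/
theorem exists_cnt_coneSet_mul_le (hdet : (A.submatrix id e).det ≠ 0) {Y : Finset (Fin n → ℕ)}
    (hY : Set.InjOn (cls A e) Y) :
    ∃ s : ℕ, ∀ t, cnt (coneSet A e) t * Y.card ≤
      cnt (goodSet A e Y) (t + s) * Nat.card (classGroup A (A.submatrix id e)) := by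
  classical
  have hfin := (card_classGroup_mul_gcdMinor_le A e.toEmbedding hdet).1
  change Finite (classGroup A (A.submatrix id e)) at hfin
  have := Fintype.ofFinite (classGroup A (A.submatrix id e))
  obtain ⟨v, hv, hvp⟩ := exists_deep_representatives hdet Y
  obtain ⟨s, hs⟩ := exists_nat_ge (∑ g, ‖v g‖)
  have hvs : ∀ g, ‖v g‖ ≤ s := fun g => (Finset.single_le_sum (f := fun g => ‖v g‖)
    (fun _ _ => norm_nonneg _) (Finset.mem_univ g)).trans hs
  refine ⟨s, fun t => ?_⟩
  set L := LinearMap.range (A.submatrix id e).mulVecLin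
  have hmem : ∀ b ∈ coneSet A e, ∀ y, cls A e y - L.mkQ b ∈ classGroup A (A.submatrix id e) :=
    fun b hb y => Submodule.sub_mem _ (cls_mem y) (Submodule.mem_map_of_mem hb.1)
  let F : (Fin m → ℤ) × (Fin n → ℕ) → (Fin m → ℤ) × ((Fin m → ℤ) ⧸ L) := fun a =>
    (if h : cls A e a.2 - L.mkQ a.1 ∈ classGroup A (A.submatrix id e) then a.1 + v ⟨_, h⟩ else 0,
      L.mkQ a.1)
  have hmap : ∀ a ∈ {b | b ∈ coneSet A e ∧ ‖b‖ ≤ (t : ℝ)} ×ˢ (Y : Set (Fin n → ℕ)),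
      F a ∈ {b | b ∈ goodSet A e Y ∧ ‖b‖ ≤ ((t + s : ℕ) : ℝ)} ×ˢ
        (classGroup A (A.submatrix id e) : Set ((Fin m → ℤ) ⧸ L)) := by
    rintro ⟨b, y⟩ ⟨⟨hb, hbt⟩, hy⟩
    have hg := hmem b hb y
    refine ⟨?_, Submodule.mem_map_of_mem hb.1⟩
    simp only [F, dif_pos hg]
    obtain ⟨p, hp, hp0, hpy⟩ := hvp ⟨_, hg⟩
    obtain ⟨x, hx0, hx⟩ := hb.2
    have hcls : L.mkQ (b + v ⟨_, hg⟩) = cls A e y := by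
      rw [map_add, hv, add_sub_cancel]
    obtain ⟨z, hz⟩ : b + v ⟨_, hg⟩ - A.mulVec (fun j => (y j : ℤ)) ∈ L :=
      (Submodule.Quotient.eq L).1 hcls
    have hxp : ((A.submatrix id e).map (Int.cast : ℤ → ℝ)).mulVec (x + p) =
        fun i => (((b + v ⟨_, hg⟩) i : ℤ) : ℝ) := by
      rw [Matrix.mulVec_add, hx, hp]
      ext i
      simp
    obtain ⟨q, hq⟩ := exists_mulVec_eq hdet (fun i => (A.mulVec (fun j => (y j : ℤ)) i : ℝ))
    -- Since `p` dominates `q` and `x ≥ 0`, this shows `z ≥ 0`.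
    have hzq : (fun i => (z i : ℝ)) = x + p - q := by
      refine mulVec_map_injective hdet ?_
      rw [map_mulVec_cast, Matrix.mulVec_sub, hxp, hq, ← Matrix.mulVecLin_apply, hz]
      ext i
      simp
    refine ⟨⟨⟨y, hy, z, fun i => ?_, ?_⟩, x + p, fun i => add_pos_of_nonneg_of_pos (hx0 i) (hp0 i),
      hxp⟩, ?_⟩
    · have h1 := congrFun hzq i
      have h2 := hpy y hy q hq i
      have h3 := hx0 i
      simp only [Pi.add_apply, Pi.sub_apply] at h1
      have : (0 : ℝ) ≤ (z i : ℝ) := by linarith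
      exact_mod_cast this
    · rw [Matrix.mulVecLin_apply] at hz
      rw [hz]
      abel
    · push_cast
      exact (norm_add_le _ _).trans (add_le_add hbt (hvs _))
  have hinj : Set.InjOn F ({b | b ∈ coneSet A e ∧ ‖b‖ ≤ (t : ℝ)} ×ˢ (Y : Set (Fin n → ℕ))) := by
    rintro ⟨b, y⟩ ⟨⟨hb, -⟩, hy⟩ ⟨b', y'⟩ ⟨⟨hb', -⟩, hy'⟩ hF
    have hg := hmem b hb y
    have hg' := hmem b' hb' y'
    simp only [F, dif_pos hg, dif_pos hg', Prod.mk.injEq] at hF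
    obtain ⟨h1, h2⟩ := hF
    have h3 := congrArg L.mkQ h1
    rw [map_add, map_add, hv, hv, add_sub_cancel, add_sub_cancel] at h3
    have hyy : y = y' := hY hy hy' h3
    subst hyy
    have hvv : v ⟨_, hg⟩ = v ⟨_, hg'⟩ := by congr 2; rw [h2]
    rw [hvv] at h1
    rw [add_right_cancel h1]
  have hle := Set.ncard_le_ncard_of_injOn F hmap hinj
    ((finite_cnt _ _).prod (Set.toFinite _))
  rw [Set.ncard_prod, Set.ncard_prod, Set.ncard_coe_finset] at hle
  exact hle

end

/-! ### Consequences of LP uniqueness: cones and hyperplanes. -/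

section

variable {m n : ℕ} {A : Matrix (Fin m) (Fin n) ℤ} {c : Fin n → ℚ} {e : Fin m ↪o Fin n}
  {b : Fin m → ℤ}

/-- A small step from `x` along `d` stays feasible and loses no objective value, so it reaches an
optimum again, which must be `x`. -/
theorem eq_zero_of_direction {x d : Fin n → ℝ} (hunique : ∃! x, LPOptimal A c b x)
    (hx : LPOptimal A c b x) (hA : (A.map (Int.cast : ℤ → ℝ)).mulVec d = 0)
    (hc : 0 ≤ ∑ j, (c j : ℝ) * d j) (hd : ∀ j, d j < 0 → 0 < x j) : d = 0 := by
  have hev : ∀ᶠ ε : ℝ in 𝓝[>] 0, ∀ j, 0 ≤ x j + ε * d j := by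
    refine eventually_all.2 fun j => ?_
    rcases lt_or_ge (d j) 0 with hj | hj
    · have hcont : Continuous fun ε : ℝ => x j + ε * d j := by fun_prop
      have htend : Tendsto (fun ε : ℝ => x j + ε * d j) (𝓝[>] 0) (𝓝 (x j)) := by
        simpa using (hcont.tendsto 0).mono_left nhdsWithin_le_nhds
      filter_upwards [htend.eventually_const_lt (hd j hj)] with ε hε using hε.le
    · filter_upwards [self_mem_nhdsWithin] with ε hε
      exact add_nonneg (hx.1.2 j) (mul_nonneg (le_of_lt hε) hj)
  obtain ⟨ε, hε, hpos⟩ := (hev.and self_mem_nhdsWithin).exists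
  have hpos : 0 < ε := hpos
  have hfeas : LPFeasible A b (x + ε • d) := by
    refine ⟨?_, fun j => by simpa using hε j⟩
    rw [Matrix.mulVec_add, Matrix.mulVec_smul, hA, hx.1.1, smul_zero, add_zero]
  have hobj : ∑ j, (c j : ℝ) * (x + ε • d) j =
      ∑ j, (c j : ℝ) * x j + ε * ∑ j, (c j : ℝ) * d j := by
    rw [Finset.mul_sum, ← Finset.sum_add_distrib]
    refine Finset.sum_congr rfl fun j _ => ?_
    simp only [Pi.add_apply, Pi.smul_apply, smul_eq_mul]
    ring
  have hopt : LPOptimal A c b (x + ε • d) := by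
    refine ⟨hfeas, fun y hy => (hx.2 y hy).trans ?_⟩
    rw [hobj]
    have := mul_nonneg hpos.le hc
    linarith
  have h := hunique.unique hopt hx
  rw [add_eq_left, smul_eq_zero] at h
  exact h.resolve_left hpos.ne'

/-- A dependence among the support columns gives a kernel direction `d`; one of `d` and `-d` does
not decrease the objective. -/
theorem linearIndepOn_support {x : Fin n → ℝ} (hunique : ∃! x, LPOptimal A c b x)
    (hx : LPOptimal A c b x) :
    LinearIndepOn ℝ (fun j k => (A k j : ℝ)) {j | 0 < x j} := by
  classical
  rw [linearIndepOn_iff']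
  intro s g hs hg j hj
  set d : Fin n → ℝ := fun j => if j ∈ s then g j else 0 with hd
  have hA : (A.map (Int.cast : ℤ → ℝ)).mulVec d = 0 := by
    rw [← hg]
    ext k
    simp [Matrix.mulVec, dotProduct, hd, mul_comm]
  have hpos : ∀ j, d j ≠ 0 → 0 < x j := fun j hj => by
    by_cases hjs : j ∈ s
    · exact hs hjs
    · simp [hd, hjs] at hj
  have hzero : d = 0 := by
    rcases le_total 0 (∑ j, (c j : ℝ) * d j) with h | h
    · exact eq_zero_of_direction hunique hx hA h fun j hj => hpos j hj.ne
    · rw [← neg_eq_zero]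
      refine eq_zero_of_direction hunique hx (by rw [Matrix.mulVec_neg, hA, neg_zero])
        (by simpa using h) fun j hj => hpos j ?_
      simp only [Pi.neg_apply, neg_lt_zero] at hj
      exact hj.ne'
  have := congrFun hzero j
  simpa [hd, hj] using this

theorem exists_basis_of_linearIndepOn (hrank : (A.map (Int.cast : ℤ → ℝ)).rank = m)
    {S : Set (Fin n)} (hS : LinearIndepOn ℝ (fun j k => (A k j : ℝ)) S) :
    ∃ e : Fin m ↪o Fin n, (A.submatrix id e).det ≠ 0 ∧ S ⊆ Set.range e := by
  classical
  obtain ⟨I, -, hSI, hspan, hI⟩ := exists_linearIndepOn_extension hS (Set.subset_univ S)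
  have hcard : Fintype.card I = m := by
    have h1 := finrank_span_eq_card hI
    have hrange : Set.range (fun j : I => fun k => (A k j : ℝ)) =
        (fun j k => (A k j : ℝ)) '' I := by
      ext v; simp
    have hle : Submodule.span ℝ ((fun (j : Fin n) k => (A k j : ℝ)) '' I) =
        Submodule.span ℝ (Set.range (A.map (Int.cast : ℤ → ℝ)).col) := by
      refine le_antisymm (Submodule.span_mono ?_) (Submodule.span_le.2 ?_)
      · rintro _ ⟨j, -, rfl⟩
        exact ⟨j, rfl⟩
      · rintro _ ⟨j, rfl⟩
        exact hspan ⟨j, trivial, rfl⟩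
    rw [hrange, hle, ← Matrix.rank_eq_finrank_span_cols, hrank] at h1
    exact h1.symm
  have hcard' : I.toFinset.card = m := by rw [Set.toFinset_card, hcard]
  refine ⟨I.toFinset.orderEmbOfFin hcard', ?_, ?_⟩
  · have hmem : ∀ i, I.toFinset.orderEmbOfFin hcard' i ∈ I := fun i =>
      Set.mem_toFinset.1 (Finset.orderEmbOfFin_mem _ hcard' i)
    have hli : LinearIndependent ℝ ((A.submatrix id
        (I.toFinset.orderEmbOfFin hcard')).map (Int.cast : ℤ → ℝ)).col :=
      LinearIndependent.comp hI (fun i => (⟨_, hmem i⟩ : I)) fun i i' h =>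
        (I.toFinset.orderEmbOfFin hcard').injective (Subtype.mk.inj h)
    have hunit := (Matrix.isUnit_iff_isUnit_det _).1 (Matrix.linearIndependent_cols_iff_isUnit.1 hli)
    intro h0
    have hdet : ((A.submatrix id (I.toFinset.orderEmbOfFin hcard')).map
        (Int.cast : ℤ → ℝ)).det = ((A.submatrix id (I.toFinset.orderEmbOfFin hcard')).det : ℝ) :=
      (Int.cast_det _).symm
    rw [hdet, h0] at hunit
    simp at hunit
  · rw [Finset.range_orderEmbOfFin, Set.coe_toFinset]
    exact hSI

/-- If column `j` had slack at most zero, the edge direction that raises `x j` and corrects with the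
basis would not decrease the objective, yet it is nonzero. -/
theorem exists_isStrictBasis {x : Fin m → ℝ} (hdet : (A.submatrix id e).det ≠ 0)
    (hunique : ∃! x, LPOptimal A c b x) (hpos : ∀ i, 0 < x i)
    (hx : LPOptimal A c b (Function.extend e x 0)) : ∃ u, IsStrictBasis A c e u := by
  have hunit := isUnit_iff_ne_zero.2 (det_map_ne hdet)
  set B := (A.submatrix id e).map (Int.cast : ℤ → ℝ) with hB
  set u : Fin m → ℝ := Matrix.vecMul (fun i => (c (e i) : ℝ)) B⁻¹ with hu
  have hbasic : ∀ i, (c (e i) : ℝ) = ∑ k, u k * (A k (e i) : ℝ) := fun i => by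
    have : Matrix.vecMul u B = fun i => (c (e i) : ℝ) := by
      rw [hu, Matrix.vecMul_vecMul, Matrix.nonsing_inv_mul _ hunit, Matrix.vecMul_one]
    exact (congrFun this i).symm
  refine ⟨u, hdet, hbasic, fun j hj => ?_⟩
  obtain ⟨p, hp⟩ := exists_mulVec_eq hdet (fun k => (A k j : ℝ))
  set d : Fin n → ℝ := Pi.single j 1 - Function.extend e p 0 with hd
  have hdj : d j = 1 := by simp [hd, Function.extend_apply' _ _ _ hj]
  have hA : (A.map (Int.cast : ℤ → ℝ)).mulVec d = 0 := by
    rw [hd, Matrix.mulVec_sub, mulVec_extend, Matrix.submatrix_map, hp, Matrix.mulVec_single_one]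
    ext k
    simp
  have hslack : ∑ i, slack A c u i * d i = slack A c u j := by
    simp only [hd, Pi.sub_apply, mul_sub, Finset.sum_sub_distrib, sum_mul_extend]
    have : ∀ i, slack A c u (e i) = 0 := fun i => by rw [slack, hbasic i, sub_self]
    simp [this, Pi.single_apply]
  by_contra hle
  have hobj : 0 ≤ ∑ j, (c j : ℝ) * d j := by
    rw [objective_eq A c u, hA, hslack, slack]
    simp only [Pi.zero_apply, mul_zero, Finset.sum_const_zero]
    linarith
  have hzero := eq_zero_of_direction hunique hx hA hobj fun i hi => by
    by_cases hir : i ∈ Set.range e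
    · obtain ⟨i, rfl⟩ := hir
      rw [e.injective.extend_apply]
      exact hpos i
    · have : 0 ≤ d i := by
        simp only [hd, Pi.sub_apply, Function.extend_apply' _ _ _ hir]
        by_cases hij : i = j
        · subst hij; simp
        · simp [hij]
      linarith
  rw [hzero] at hdj
  simp at hdj

/-- The lattice points of a linear hyperplane. -/
def hyperplane (l : Fin m → ℤ) : Set (Fin m → ℤ) := {b | ∑ k, l k * b k = 0}

theorem mem_hyperplane_or_mem_coneSet (hrank : (A.map (Int.cast : ℤ → ℝ)).rank = m)
    (hfeas : ∃ z, IPFeasible A b z) (hunique : ∃! x, LPOptimal A c b x) :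
    (∃ (e : Fin m ↪o Fin n) (i : Fin m), (A.submatrix id e).det ≠ 0 ∧
      b ∈ hyperplane ((A.submatrix id e).adjugate i)) ∨
    ∃ e, (∃ u, IsStrictBasis A c e u) ∧ b ∈ coneSet A e := by
  obtain ⟨x, hx, -⟩ := id hunique
  obtain ⟨e, hdet, hsupp⟩ := exists_basis_of_linearIndepOn hrank (linearIndepOn_support hunique hx)
  have hext : x = Function.extend e (fun i => x (e i)) 0 := by
    ext j
    by_cases hj : j ∈ Set.range e
    · obtain ⟨i, rfl⟩ := hj
      rw [e.injective.extend_apply]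
    · rw [Function.extend_apply' _ _ _ hj]
      exact le_antisymm (not_lt.1 fun h => hj (hsupp h)) (hx.1.2 j)
  have hB : ((A.submatrix id e).map (Int.cast : ℤ → ℝ)).mulVec (fun i => x (e i)) =
      fun i => (b i : ℝ) := by
    rw [← hx.1.1]
    conv_rhs => rw [hext]
    rw [mulVec_extend, Matrix.submatrix_map]
  by_cases hpos : ∀ i, 0 < x (e i)
  · refine Or.inr ⟨e, ?_, ?_, fun i => x (e i), fun i => (hpos i).le, hB⟩
    · rw [hext] at hx
      exact exists_isStrictBasis hdet hunique hpos hx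
    · obtain ⟨z, hz⟩ := hfeas
      exact ⟨z, hz.1⟩
  · push Not at hpos
    obtain ⟨i, hi⟩ := hpos
    refine Or.inl ⟨e, i, hdet, ?_⟩
    -- A vanishing basic coordinate puts `b` on the hyperplane normal to row `i` of the adjugate,
    -- since `adj B · b = det B · x`.
    have hi0 : x (e i) = 0 := le_antisymm hi (hx.1.2 _)
    have h1 : ((A.submatrix id e).map (Int.cast : ℤ → ℝ)).adjugate.mulVec
        (fun i => (b i : ℝ)) i = 0 := by
      rw [← hB, Matrix.mulVec_mulVec, Matrix.adjugate_mul, Matrix.smul_mulVec, Matrix.one_mulVec]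
      simp [hi0]
    have h2 : ((A.submatrix id e).map (Int.cast : ℤ → ℝ)).adjugate =
        (A.submatrix id e).adjugate.map (Int.cast : ℤ → ℝ) :=
      ((Int.castRingHom ℝ).map_adjugate (A.submatrix id e)).symm
    rw [h2, map_mulVec_cast] at h1
    exact Int.cast_eq_zero.1 h1

theorem adjugate_row_ne_zero {B : Matrix (Fin m) (Fin m) ℤ} (hdet : B.det ≠ 0) (i : Fin m) :
    B.adjugate i ≠ 0 := fun h => by
  have h1 := congrFun (congrFun B.adjugate_mul i) i
  rw [Matrix.mul_apply] at h1
  simp [h] at h1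
  exact hdet h1.symm

/-- With `l i ≠ 0`, the other coordinates determine a point of the hyperplane; letting coordinate
`i` run freely therefore embeds the product into the box. -/
theorem cnt_hyperplane_mul_le {l : Fin m → ℤ} (hl : l ≠ 0) (t : ℕ) :
    cnt (hyperplane l) t * (2 * t + 1) ≤ (2 * t + 1) ^ m := by
  obtain ⟨i, hi⟩ := Function.ne_iff.1 hl
  have hcard : ((Finset.Icc (-(t : ℤ)) t : Finset ℤ) : Set ℤ).ncard = 2 * t + 1 := by
    rw [Set.ncard_coe_finset, Int.card_Icc]
    omega
  rw [← ncard_norm_le]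
  conv_lhs => rw [← hcard]
  rw [cnt, ← Set.ncard_prod]
  refine Set.ncard_le_ncard_of_injOn (fun a => Function.update a.1 i a.2) ?_ ?_ (finite_norm_le t)
  · rintro ⟨b, a⟩ ⟨⟨-, hb⟩, ha⟩
    have hb : b ∈ {b : Fin m → ℤ | ‖b‖ ≤ (t : ℝ)} := hb
    rw [setOf_norm_le_eq, Finset.mem_coe, Fintype.mem_piFinset] at hb ⊢
    intro k
    by_cases hk : k = i
    · subst hk; simpa using ha
    · simpa [hk] using hb k
  · rintro ⟨b, a⟩ ⟨⟨hb, -⟩, -⟩ ⟨b', a'⟩ ⟨⟨hb', -⟩, -⟩ h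
    have ha : a = a' := by simpa using congrFun h i
    have hne : ∀ k, k ≠ i → b k = b' k := fun k hk => by simpa [hk] using congrFun h k
    have hsum : ∑ k, l k * (b k - b' k) = 0 := by
      simp only [mul_sub, Finset.sum_sub_distrib]
      rw [show ∑ k, l k * b k = 0 from hb, show ∑ k, l k * b' k = 0 from hb', sub_zero]
    rw [Finset.sum_eq_single i (fun k _ hk => by rw [hne k hk, sub_self, mul_zero])
      (fun h => absurd (Finset.mem_univ i) h)] at hsum
    have hbi : b i = b' i := sub_eq_zero.1 ((mul_eq_zero.1 hsum).resolve_left hi)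
    rw [Prod.mk.injEq]
    refine ⟨funext fun k => ?_, ha⟩
    by_cases hk : k = i
    · rw [hk, hbi]
    · exact hne k hk

/-- Strict positivity in `goodSet` makes the support of the LP optimum equal to the range of `e`,
and an order embedding is determined by its range. -/
theorem eq_of_mem_goodSet {e e' : Fin m ↪o Fin n} {u u' : Fin m → ℝ} (h : IsStrictBasis A c e u)
    (h' : IsStrictBasis A c e' u') (hunique : ∃! x, LPOptimal A c b x)
    {Y Y' : Finset (Fin n → ℕ)} (hb : b ∈ goodSet A e Y) (hb' : b ∈ goodSet A e' Y') : e = e' := by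
  obtain ⟨-, x, hx0, hx⟩ := hb
  obtain ⟨-, x', hx0', hx'⟩ := hb'
  have heq := hunique.unique (h.lpOptimal_extend (fun i => (hx0 i).le) hx)
    (h'.lpOptimal_extend (fun i => (hx0' i).le) hx')
  have hrange : ∀ (e : Fin m ↪o Fin n) (x : Fin m → ℝ), (∀ i, 0 < x i) →
      Set.range e = {j | Function.extend e x 0 j ≠ 0} := fun e x hx => by
    ext j
    by_cases hj : j ∈ Set.range e
    · obtain ⟨i, rfl⟩ := hj
      simp [e.injective.extend_apply, (hx i).ne']
    · simp only [hj, Set.mem_ofPred_eq, Function.extend_apply' _ _ _ hj]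
      simp
  refine DFunLike.coe_injective ((StrictMono.range_inj e.strictMono e'.strictMono).1 ?_)
  rw [hrange e x hx0, hrange e' x' hx0', heq]

end

/-! ### Counting estimates and lower density. -/

section

variable {m n : ℕ} {A : Matrix (Fin m) (Fin n) ℤ} {c : Fin n → ℚ}

open scoped Classical in
theorem cnt_eq_card (S : Set (Fin m → ℤ)) (t : ℕ) :
    cnt S t = ((finite_norm_le t).toFinset.filter (· ∈ S)).card := by
  rw [cnt, ← Set.ncard_coe_finset]
  congr 1
  ext b
  simp [and_comm]

theorem cnt_union_le (S T : Set (Fin m → ℤ)) (t : ℕ) : cnt (S ∪ T) t ≤ cnt S t + cnt T t := by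
  refine (Set.ncard_le_ncard (fun b hb => ?_) ((finite_cnt S t).union (finite_cnt T t))).trans
    (Set.ncard_union_le _ _)
  exact hb.1.imp (fun h => ⟨h, hb.2⟩) fun h => ⟨h, hb.2⟩

theorem cnt_biUnion_le {ι : Type*} (s : Finset ι) (S : ι → Set (Fin m → ℤ)) (t : ℕ) :
    cnt (⋃ i ∈ s, S i) t ≤ ∑ i ∈ s, cnt (S i) t := by
  classical
  simp only [cnt_eq_card]
  refine (Finset.card_le_card fun b hb => ?_).trans Finset.card_biUnion_le
  simp only [Finset.mem_filter, Set.mem_iUnion, Finset.mem_biUnion, exists_prop] at hb ⊢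
  obtain ⟨h, i, hi, hbi⟩ := hb
  exact ⟨i, hi, h, hbi⟩

theorem sum_cnt_le {ι : Type*} (s : Finset ι) (S : ι → Set (Fin m → ℤ)) {T : Set (Fin m → ℤ)}
    (hST : ∀ i ∈ s, S i ⊆ T) (hdisj : ∀ i ∈ s, ∀ j ∈ s, ∀ b, b ∈ S i → b ∈ S j → i = j) (t : ℕ) :
    ∑ i ∈ s, cnt (S i) t ≤ cnt T t := by
  classical
  simp only [cnt_eq_card]
  rw [← Finset.card_biUnion]
  · refine Finset.card_le_card fun b hb => ?_
    simp only [Finset.mem_biUnion, Finset.mem_filter] at hb ⊢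
    obtain ⟨i, hi, h1, h2⟩ := hb
    exact ⟨h1, hST i hi h2⟩
  · intro i hi j hj hij
    refine Finset.disjoint_left.2 fun b hb hb' => hij ?_
    exact hdisj i hi j hj b (Finset.mem_filter.1 hb).2 (Finset.mem_filter.1 hb').2

theorem exists_norm_mulVec_le (B : Matrix (Fin m) (Fin m) ℤ) :
    ∃ C : ℕ, 0 < C ∧ ∀ (M : ℕ) (z : Fin m → ℤ), (∀ i, |z i| ≤ M) →
      ‖B.mulVec z‖ ≤ ((C * M : ℕ) : ℝ) := by
  obtain ⟨C, hC⟩ : ∃ C : ℕ, ∀ k, ∑ i, (B k i).natAbs ≤ C :=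
    ⟨∑ k, ∑ i, (B k i).natAbs, fun k => Finset.single_le_sum
      (f := fun k => ∑ i, (B k i).natAbs) (fun _ _ => Nat.zero_le _) (Finset.mem_univ k)⟩
  refine ⟨C + 1, C.succ_pos, fun M z hz => ?_⟩
  refine (pi_norm_le_iff_of_nonneg (Nat.cast_nonneg _)).2 fun k => ?_
  have h : |B.mulVec z k| ≤ (((C + 1) * M : ℕ) : ℤ) := by
    have hk : B.mulVec z k = ∑ i, B k i * z i := rfl
    rw [hk]
    calc |∑ i, B k i * z i| ≤ ∑ i, |B k i * z i| := Finset.abs_sum_le_sum_abs _ _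
      _ ≤ ∑ i, ((B k i).natAbs : ℤ) * M := by
          refine Finset.sum_le_sum fun i _ => ?_
          rw [abs_mul, Int.abs_eq_natAbs (B k i)]
          exact mul_le_mul_of_nonneg_left (hz i) (Int.natCast_nonneg _)
      _ = (((∑ i, (B k i).natAbs) * M : ℕ) : ℤ) := by
          rw [← Finset.sum_mul]
          push_cast
          rfl
      _ ≤ (((C + 1) * M : ℕ) : ℤ) :=
          Int.ofNat_le.2 (Nat.mul_le_mul_right _ ((hC k).trans C.le_succ))
  rw [Int.norm_eq_abs]
  exact_mod_cast h

/-- The points `B z` with `z ∈ {0, …, M}ᵐ` and `M = ⌊t/C⌋` are feasible, distinct and inside the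
box. -/
theorem exists_pow_le_cnt_feasible {e : Fin m ↪o Fin n} (hdet : (A.submatrix id e).det ≠ 0) :
    ∃ C : ℕ, 0 < C ∧ ∀ t, (2 * t + 1) ^ m ≤ C * cnt {b | ∃ z, IPFeasible A b z} t := by
  obtain ⟨C, hC0, hC⟩ := exists_norm_mulVec_le (A.submatrix id e)
  refine ⟨(2 * C) ^ m, by positivity, fun t => ?_⟩
  obtain ⟨M, hM, hMt⟩ : ∃ M, t + 1 ≤ C * (M + 1) ∧ C * M ≤ t :=
    ⟨t / C, Nat.lt_mul_div_succ t hC0, Nat.mul_div_le t C⟩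
  have hcard : (M + 1) ^ m ≤ cnt {b | ∃ z, IPFeasible A b z} t := by
    have h1 : ((Fintype.piFinset fun _ : Fin m => Finset.Icc (0 : ℤ) M :
        Finset (Fin m → ℤ)) : Set (Fin m → ℤ)).ncard = (M + 1) ^ m := by
      rw [Set.ncard_coe_finset, Fintype.card_piFinset]
      simp
    rw [← h1]
    refine Set.ncard_le_ncard_of_injOn (A.submatrix id e).mulVec (fun z hz => ?_)
      (fun z _ z' _ hzz => ?_) (finite_cnt _ _)
    · have hz : ∀ i, 0 ≤ z i ∧ z i ≤ M := fun i =>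
        Finset.mem_Icc.1 (Fintype.mem_piFinset.1 (Finset.mem_coe.1 hz) i)
      refine ⟨⟨Function.extend e z 0, mulVec_extend A e z, fun j => ?_⟩, ?_⟩
      · by_cases hj : j ∈ Set.range e
        · obtain ⟨i, rfl⟩ := hj
          rw [e.injective.extend_apply]
          exact (hz i).1
        · rw [Function.extend_apply' _ _ _ hj]
          rfl
      · exact (hC M z fun i => by rw [abs_of_nonneg (hz i).1]; exact (hz i).2).trans
          (Nat.cast_le.2 hMt)
    · have hzz : (A.submatrix id e).mulVec z = (A.submatrix id e).mulVec z' := hzz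
      rw [← sub_eq_zero, ← Matrix.mulVec_sub] at hzz
      exact sub_eq_zero.1 (Matrix.eq_zero_of_mulVec_eq_zero hdet hzz)
  calc (2 * t + 1) ^ m ≤ (2 * C * (M + 1)) ^ m := Nat.pow_le_pow_left (by
        rw [mul_assoc]
        omega) m
    _ = (2 * C) ^ m * (M + 1) ^ m := mul_pow _ _ _
    _ ≤ _ := Nat.mul_le_mul_left _ hcard

theorem tendsto_box_diff_div (m s : ℕ) :
    Tendsto (fun t : ℕ => ((2 * ((t : ℝ) + s) + 1) ^ m - (2 * (t : ℝ) + 1) ^ m) /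
      (2 * (t : ℝ) + 1) ^ m) atTop (𝓝 0) := by
  have hlin : Tendsto (fun t : ℕ => 2 * (t : ℝ) + 1) atTop atTop :=
    tendsto_atTop_add_const_right _ _
      (tendsto_natCast_atTop_atTop.const_mul_atTop (by norm_num : (0 : ℝ) < 2))
  have h1 : Tendsto (fun t : ℕ => (1 + 2 * (s : ℝ) / (2 * (t : ℝ) + 1)) ^ m - 1) atTop (𝓝 0) := by
    have := ((hlin.const_div_atTop (2 * (s : ℝ))).const_add 1).pow m
    simpa using this.sub_const 1
  refine h1.congr fun t => ?_
  have hpos : (0 : ℝ) < 2 * (t : ℝ) + 1 := by positivity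
  have h2 : 1 + 2 * (s : ℝ) / (2 * (t : ℝ) + 1) =
      (2 * ((t : ℝ) + s) + 1) / (2 * (t : ℝ) + 1) := by
    field_simp
    ring
  rw [h2, div_pow, sub_div, div_self (pow_pos hpos m).ne']

theorem tendsto_cnt_hyperplane_div {l : Fin m → ℤ} (hl : l ≠ 0) :
    Tendsto (fun t : ℕ => (cnt (hyperplane l) t : ℝ) / (2 * (t : ℝ) + 1) ^ m) atTop (𝓝 0) := by
  have hlin : Tendsto (fun t : ℕ => 2 * (t : ℝ) + 1) atTop atTop :=
    tendsto_atTop_add_const_right _ _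
      (tendsto_natCast_atTop_atTop.const_mul_atTop (by norm_num : (0 : ℝ) < 2))
  refine squeeze_zero (fun t => by positivity) (fun t => ?_) (hlin.const_div_atTop 1)
  rw [div_le_div_iff₀ (by positivity) (by positivity), one_mul]
  exact_mod_cast cnt_hyperplane_mul_le hl t

theorem prT_le_one (f : (Fin m → ℤ) → ℝ≥0∞) (t : ℕ) (E : Set (Fin m → ℤ)) : prT f t E ≤ 1 := by
  refine div_le_one_of_le₀ ?_ (Nat.cast_nonneg _)
  exact Nat.cast_le.2 (Set.ncard_le_ncard (fun b hb => hb.2)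
    ((finite_norm_le t).subset fun b hb => hb.1))

theorem prT_nonneg (f : (Fin m → ℤ) → ℝ≥0∞) (t : ℕ) (E : Set (Fin m → ℤ)) : 0 ≤ prT f t E :=
  div_nonneg (Nat.cast_nonneg _) (Nat.cast_nonneg _)

theorem prLE_le_one (f : (Fin m → ℤ) → ℝ≥0∞) (α : ℝ) : prLE f α ≤ 1 := by
  have h : liminf (fun t : ℕ => prT f t {b | f b ≤ ENNReal.ofReal α}) atTop ≤
      liminf (fun _ : ℕ => (1 : ℝ)) atTop :=
    liminf_le_liminf (Eventually.of_forall fun t => prT_le_one f t _)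
      (isBoundedUnder_of ⟨0, fun t => prT_nonneg f t _⟩)
      (isBoundedUnder_of (r := (· ≤ ·)) ⟨1, fun _ => le_rfl⟩).isCoboundedUnder_ge
  rwa [liminf_const] at h

/-- A lower bound on the density, up to errors of lower order than the volume of the box. -/
theorem le_prLE_of_count_le {f : (Fin m → ℤ) → ℝ≥0∞} {α q : ℝ} {I : Set (Fin m → ℤ)} {E : ℕ → ℝ}
    {C : ℕ} (hC : 0 < C) (hfI : ∀ b, f b < ∞ → b ∈ I)
    (hI : ∀ t, (2 * t + 1) ^ m ≤ C * cnt I t) (hE0 : ∀ t, 0 ≤ E t)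
    (hE : Tendsto (fun t : ℕ => E t / (2 * (t : ℝ) + 1) ^ m) atTop (𝓝 0))
    (hcount : ∀ t, q * cnt I t ≤ cnt {b | f b ≤ ENNReal.ofReal α} t + E t) : q ≤ prLE f α := by
  have hlow : Tendsto (fun t : ℕ => q - C * (E t / (2 * (t : ℝ) + 1) ^ m)) atTop (𝓝 q) := by
    simpa using (hE.const_mul (C : ℝ)).const_sub q
  rw [← hlow.liminf_eq]
  refine liminf_le_liminf (Eventually.of_forall fun t => ?_) hlow.isBoundedUnder_ge
    (isBoundedUnder_of (r := (· ≤ ·)) ⟨1, fun t => prT_le_one f t _⟩).isCoboundedUnder_ge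
  have hV : (0 : ℝ) < (2 * (t : ℝ) + 1) ^ m := by positivity
  have hIV : (2 * (t : ℝ) + 1) ^ m ≤ C * cnt I t := by exact_mod_cast hI t
  have hC' : (0 : ℝ) < C := Nat.cast_pos.2 hC
  have hIpos : (0 : ℝ) < cnt I t := by
    by_contra h
    have := mul_nonpos_of_nonneg_of_nonpos hC'.le (not_lt.1 h)
    linarith
  set N : ℝ := (cnt {b | f b ≤ ENNReal.ofReal α} t : ℝ) with hN
  set F : ℝ := (Set.ncard {b : Fin m → ℤ | ‖b‖ ≤ (t : ℝ) ∧ f b < ∞} : ℝ) with hF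
  have hpr : prT f t {b | f b ≤ ENNReal.ofReal α} = N / F := by
    rw [prT, hN, hF, cnt]
    congr 3
    ext b
    constructor
    · exact fun h => ⟨h.1, h.2.1⟩
    · exact fun h => ⟨h.1, h.2, lt_of_le_of_lt h.1 ENNReal.ofReal_lt_top⟩
  have hFI : F ≤ cnt I t := Nat.cast_le.2
    (Set.ncard_le_ncard (fun b hb => ⟨hfI b hb.2, hb.1⟩) (finite_cnt I t))
  have hNF : N ≤ F := Nat.cast_le.2 (Set.ncard_le_ncard
    (fun b hb => ⟨hb.2, lt_of_le_of_lt hb.1 ENNReal.ofReal_lt_top⟩)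
    ((finite_norm_le t).subset fun b hb => hb.1))
  have hN0 : 0 ≤ N := Nat.cast_nonneg _
  have h1 : N / cnt I t ≤ N / F := by
    -- If the denominator is zero then so is the numerator, and both quotients are `0` by
    -- convention.
    rcases (Nat.cast_nonneg _ : 0 ≤ F).eq_or_lt with h | h
    · have : N = 0 := le_antisymm (h ▸ hNF) hN0
      rw [this, zero_div, zero_div]
    · exact div_le_div_of_nonneg_left hN0 h hFI
  have h2 : q - E t / cnt I t ≤ N / cnt I t := by
    rw [sub_le_iff_le_add, ← add_div, le_div_iff₀ hIpos]
    exact hcount t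
  have h3 : E t / cnt I t ≤ C * (E t / (2 * (t : ℝ) + 1) ^ m) := by
    rw [mul_div_assoc', div_le_div_iff₀ hIpos hV]
    have := mul_le_mul_of_nonneg_left hIV (hE0 t)
    linarith
  rw [hpr]
  linarith

/-! ### Assembly over all strict bases. -/

/-- Cones of strict bases and degenerate hyperplanes cover the feasible `b`, while the good sets are
disjoint; so a share `q` in each cone adds up to a share `q` overall. The error consists of
hyperplanes and boundary layers. -/
theorem le_prLE_of_goodSet (hrank : (A.map (Int.cast : ℤ → ℝ)).rank = m)
    (hunique : ∀ b : Fin m → ℤ, (∃ z, IPFeasible A b z) → ∃! x, LPOptimal A c b x)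
    {f : (Fin m → ℤ) → ℝ≥0∞} {α q : ℝ} (hq : 0 ≤ q)
    (hf : ∀ b, f b < ∞ → ∃ z, IPFeasible A b z)
    (hgood : ∀ (e : Fin m ↪o Fin n) (u : Fin m → ℝ), IsStrictBasis A c e u →
      ∃ Y : Finset (Fin n → ℕ), Set.InjOn (cls A e) Y ∧
        q * Nat.card (classGroup A (A.submatrix id e)) ≤ Y.card ∧
        ∀ b ∈ goodSet A e Y, (∃ z, IPFeasible A b z) ∧ f b ≤ ENNReal.ofReal α) :
    q ≤ prLE f α := by
  classical
  have : Finite (Fin m ↪o Fin n) :=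
    Finite.of_injective (fun e : Fin m ↪o Fin n => (e : Fin m → Fin n)) DFunLike.coe_injective
  have := Fintype.ofFinite (Fin m ↪o Fin n)
  set P : Finset ((Fin m ↪o Fin n) × Fin m) :=
    Finset.univ.filter fun p => (A.submatrix id p.1).det ≠ 0 with hP
  set S : Finset (Fin m ↪o Fin n) := Finset.univ.filter fun e => ∃ u, IsStrictBasis A c e u with hS
  have hstep : ∀ e, ∃ (Y : Finset (Fin n → ℕ)) (s : ℕ), e ∈ S →
      (∀ b ∈ goodSet A e Y, (∃ z, IPFeasible A b z) ∧ f b ≤ ENNReal.ofReal α) ∧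
      ∀ t, q * cnt (coneSet A e) t ≤ cnt (goodSet A e Y) t +
        ((2 * ((t : ℝ) + s) + 1) ^ m - (2 * (t : ℝ) + 1) ^ m) := by
    intro e
    by_cases he : e ∈ S
    · obtain ⟨u, hu⟩ := (Finset.mem_filter.1 he).2
      obtain ⟨Y, hYinj, hYcard, hYgood⟩ := hgood e u hu
      obtain ⟨s, hs⟩ := exists_cnt_coneSet_mul_le hu.det_ne hYinj
      refine ⟨Y, s, fun _ => ⟨hYgood, fun t => ?_⟩⟩
      have hD : (0 : ℝ) < Nat.card (classGroup A (A.submatrix id e)) :=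
        Nat.cast_pos.2 (card_classGroup_mul_gcdMinor_le A e.toEmbedding hu.det_ne).2.1
      have h1 : (cnt (coneSet A e) t : ℝ) * Y.card ≤
          cnt (goodSet A e Y) (t + s) * Nat.card (classGroup A (A.submatrix id e)) := by
        exact_mod_cast hs t
      have h2 := mul_le_mul_of_nonneg_left hYcard (Nat.cast_nonneg (α := ℝ) (cnt (coneSet A e) t))
      have h3 : q * cnt (coneSet A e) t ≤ cnt (goodSet A e Y) (t + s) := by
        refine le_of_mul_le_mul_right ?_ hD
        linarith
      have h4 : (cnt (goodSet A e Y) (t + s) : ℝ) + (2 * (t : ℝ) + 1) ^ m ≤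
          cnt (goodSet A e Y) t + (2 * ((t : ℝ) + s) + 1) ^ m := by
        exact_mod_cast cnt_add_le (goodSet A e Y) t s
      linarith
    · exact ⟨∅, 0, fun h => absurd h he⟩
  choose Y s hYs using hstep
  obtain ⟨e₀, he₀, -⟩ := exists_basis_of_linearIndepOn hrank (linearIndepOn_empty ℝ _)
  obtain ⟨C, hC, hCt⟩ := exists_pow_le_cnt_feasible he₀
  have hbox : ∀ (s t : ℕ), 0 ≤ (2 * ((t : ℝ) + s) + 1) ^ m - (2 * (t : ℝ) + 1) ^ m := fun s t =>
    sub_nonneg.2 (pow_le_pow_left₀ (by positivity) (by linarith [Nat.cast_nonneg (α := ℝ) s]) m)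
  refine le_prLE_of_count_le (I := {b | ∃ z, IPFeasible A b z})
    (E := fun t => ∑ p ∈ P, q * cnt (hyperplane ((A.submatrix id p.1).adjugate p.2)) t +
      ∑ e ∈ S, ((2 * ((t : ℝ) + s e) + 1) ^ m - (2 * (t : ℝ) + 1) ^ m))
    hC hf hCt (fun t => ?_) ?_ (fun t => ?_)
  · exact add_nonneg (Finset.sum_nonneg fun p _ => by positivity)
      (Finset.sum_nonneg fun e _ => hbox (s e) t)
  · simp only [add_div, Finset.sum_div, mul_div_assoc]
    rw [show (0 : ℝ) = ∑ p ∈ P, q * 0 + ∑ e ∈ S, 0 by simp]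
    refine (tendsto_finsetSum _ fun p hp => Tendsto.const_mul q ?_).add
      (tendsto_finsetSum _ fun e _ => tendsto_box_diff_div m (s e))
    exact tendsto_cnt_hyperplane_div (adjugate_row_ne_zero (Finset.mem_filter.1 hp).2 _)
  · have hcover : {b | ∃ z, IPFeasible A b z} ⊆
        (⋃ p ∈ P, hyperplane ((A.submatrix id p.1).adjugate p.2)) ∪ ⋃ e ∈ S, coneSet A e := by
      intro b hb
      rcases mem_hyperplane_or_mem_coneSet hrank hb (hunique b hb) with ⟨e, i, hdet, hbe⟩ | ⟨e, he, hbe⟩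
      · exact Or.inl (Set.mem_biUnion (x := (e, i)) (by simpa [hP] using hdet) hbe)
      · exact Or.inr (Set.mem_biUnion (x := e) (by simpa [hS] using he) hbe)
    have h1 : (cnt {b | ∃ z, IPFeasible A b z} t : ℝ) ≤
        ∑ p ∈ P, (cnt (hyperplane ((A.submatrix id p.1).adjugate p.2)) t : ℝ) +
          ∑ e ∈ S, (cnt (coneSet A e) t : ℝ) := by
      exact_mod_cast (cnt_mono hcover t).trans ((cnt_union_le _ _ t).trans
        (add_le_add (cnt_biUnion_le _ _ t) (cnt_biUnion_le _ _ t)))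
    have h2 : ∑ e ∈ S, (cnt (goodSet A e (Y e)) t : ℝ) ≤ cnt {b | f b ≤ ENNReal.ofReal α} t := by
      exact_mod_cast sum_cnt_le S (fun e => goodSet A e (Y e))
        (fun e he b hb => ((hYs e he).1 b hb).2) (fun e he e' he' b hb hb' => by
          obtain ⟨u, hu⟩ := (Finset.mem_filter.1 he).2
          obtain ⟨u', hu'⟩ := (Finset.mem_filter.1 he').2
          exact eq_of_mem_goodSet hu hu' (hunique b ((hYs e he).1 b hb).1) hb hb') t
    have h3 := Finset.sum_le_sum fun e (he : e ∈ S) => (hYs e he).2 t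
    rw [Finset.sum_add_distrib] at h3
    have h4 := mul_le_mul_of_nonneg_left h1 hq
    rw [mul_add, Finset.mul_sum, Finset.mul_sum] at h4
    linarith

theorem exists_minor_ne_zero (hrank : (A.map (Int.cast : ℤ → ℝ)).rank = m) :
    ∃ e : Fin m ↪o Fin n, (A.submatrix id e).det ≠ 0 := by
  obtain ⟨e, he, -⟩ := exists_basis_of_linearIndepOn hrank (linearIndepOn_empty ℝ _)
  exact ⟨e, he⟩

theorem gcdMinor_pos (hrank : (A.map (Int.cast : ℤ → ℝ)).rank = m) : 0 < gcdMinor A := by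
  obtain ⟨e, he⟩ := exists_minor_ne_zero hrank
  refine Nat.pos_of_ne_zero fun h => he ?_
  have := gcdMinor_dvd_minor A e.toEmbedding
  rw [h] at this
  exact zero_dvd_iff.1 (by exact_mod_cast this)

theorem gcdMinor_dvd_maxMinor (hrank : (A.map (Int.cast : ℤ → ℝ)).rank = m) :
    gcdMinor A ∣ maxMinor A := by
  obtain ⟨e, -⟩ := exists_minor_ne_zero hrank
  have : Nonempty (Fin m ↪ Fin n) := ⟨e.toEmbedding⟩
  obtain ⟨f, -, hf⟩ := Finset.exists_mem_eq_sup Finset.univ Finset.univ_nonempty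
    fun e : Fin m ↪ Fin n => (A.submatrix id e).det.natAbs
  rw [maxMinor, hf]
  exact Int.natCast_dvd.1 (gcdMinor_dvd_minor A f)

theorem maxMinor_pos (hrank : (A.map (Int.cast : ℤ → ℝ)).rank = m) : 0 < maxMinor A := by
  obtain ⟨e, he⟩ := exists_minor_ne_zero hrank
  exact (Int.natAbs_pos.2 he).trans_le (natAbs_minor_le_maxMinor A e.toEmbedding)

/-- Most right-hand sides in the cone of a basis are solved by short vectors of the group
relaxation. -/
theorem IsStrictBasis.exists_goodSet (hrank : (A.map (Int.cast : ℤ → ℝ)).rank = m)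
    (hunique : ∀ b : Fin m → ℤ, (∃ z, IPFeasible A b z) → ∃! x, LPOptimal A c b x)
    {e : Fin m ↪o Fin n} {u : Fin m → ℝ} (h : IsStrictBasis A c e u) {k : ℕ}
    (hk : (k : ℝ) ≤ normMinor A - 1) :
    ∃ Y : Finset (Fin n → ℕ), Set.InjOn (cls A e) Y ∧
      ((k : ℝ) + 1) / normMinor A * Nat.card (classGroup A (A.submatrix id e)) ≤ Y.card ∧
      ∀ b ∈ goodSet A e Y, (∃ z, IPFeasible A b z) ∧
        distOne A c b ≤ ENNReal.ofReal
          ((m : ℝ) * normMinor A * ((k : ℝ) / ((k : ℝ) + 1)) + (k : ℝ)) ∧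
        distSup A c b ≤ ENNReal.ofReal (normMinor A * ((k : ℝ) / ((k : ℝ) + 1))) := by
  obtain ⟨-, hD0, hDdet⟩ := card_classGroup_mul_gcdMinor_le A e.toEmbedding h.det_ne
  change 0 < Nat.card (classGroup A (A.submatrix id e)) at hD0
  change Nat.card (classGroup A (A.submatrix id e)) * gcdMinor A ≤
    (A.submatrix id e).det.natAbs at hDdet
  set D := Nat.card (classGroup A (A.submatrix id e)) with hD
  have hγ : (0 : ℝ) < gcdMinor A := Nat.cast_pos.2 (gcdMinor_pos hrank)
  have hδ : (0 : ℝ) < maxMinor A := Nat.cast_pos.2 (maxMinor_pos hrank)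
  have hΔ : normMinor A = maxMinor A / gcdMinor A := by rw [normMinor, inv_mul_eq_div]
  have hΔ0 : 0 < normMinor A := by rw [hΔ]; positivity
  have hDΔ : (D : ℝ) ≤ normMinor A := by
    rw [hΔ, le_div_iff₀ hγ]
    exact_mod_cast hDdet.trans (natAbs_minor_le_maxMinor A e.toEmbedding)
  have hk1 : (0 : ℝ) < (k : ℝ) + 1 := by positivity
  -- Only `D` classes exist, so at most `D` can be requested; when `k ≥ D`, all of them are already
  -- covered at length `D - 1`.
  set k' := min k (D - 1) with hk'
  have hk'D : k' + 1 ≤ D := by omega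
  have hk'k : (k' : ℝ) ≤ k := Nat.cast_le.2 (min_le_left _ _)
  obtain ⟨Y, hcard, hY, hinj⟩ := h.exists_finset_isGroupOptimal hk'D
  refine ⟨Y, hinj, ?_, ?_⟩
  · rw [hcard, div_mul_eq_mul_div, div_le_iff₀ hΔ0]
    push_cast
    rcases le_total k (D - 1) with hle | hle
    · rw [hk', min_eq_left hle]
      exact mul_le_mul_of_nonneg_left hDΔ hk1.le
    · have hDk : (k' : ℝ) + 1 = D := by
        have : k' + 1 = D := by omega
        exact_mod_cast this
      rw [hDk, mul_comm]
      exact mul_le_mul_of_nonneg_left (by linarith) (Nat.cast_nonneg _)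
  · rintro b ⟨⟨y, hyY, z, hz, hb⟩, x, hx0, hx⟩
    obtain ⟨hyopt, hysum⟩ := hY y hyY
    have hysum' : ∑ j, (y j : ℝ) ≤ k' := by exact_mod_cast hysum
    have hdet : (0 : ℝ) < ((A.submatrix id e).det.natAbs : ℝ) :=
      Nat.cast_pos.2 (Int.natAbs_pos.2 h.det_ne)
    have hκ : maxMinor A / ((A.submatrix id e).det.natAbs : ℝ) * ∑ j, (y j : ℝ) ≤
        normMinor A * ((k : ℝ) / ((k : ℝ) + 1)) := by
      have h1 : ((k' : ℝ) + 1) * gcdMinor A ≤ ((A.submatrix id e).det.natAbs : ℝ) := by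
        exact_mod_cast (Nat.mul_le_mul_right _ hk'D).trans hDdet
      have hk'1 : (0 : ℝ) < (k' : ℝ) + 1 := by positivity
      calc maxMinor A / ((A.submatrix id e).det.natAbs : ℝ) * ∑ j, (y j : ℝ)
          ≤ maxMinor A / (((k' : ℝ) + 1) * gcdMinor A) * k' :=
            mul_le_mul (div_le_div_of_nonneg_left hδ.le (by positivity) h1) hysum'
              (Finset.sum_nonneg fun _ _ => Nat.cast_nonneg _) (by positivity)
        _ = normMinor A * ((k' : ℝ) / ((k' : ℝ) + 1)) := by
            rw [hΔ]
            field_simp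
        _ ≤ normMinor A * ((k : ℝ) / ((k : ℝ) + 1)) := by
            refine mul_le_mul_of_nonneg_left ?_ hΔ0.le
            rw [div_le_div_iff₀ hk'1 hk1]
            linarith
    -- As `k + 1 ≤ Δ`, the nonbasic error is dominated by the basic bound, so the sup-norm estimate
    -- has no extra `k`.
    have hrκ : (k : ℝ) ≤ normMinor A * ((k : ℝ) / ((k : ℝ) + 1)) := by
      rw [mul_div_assoc', le_div_iff₀ hk1, mul_comm]
      exact mul_le_mul_of_nonneg_right (by linarith) (Nat.cast_nonneg _)
    obtain ⟨h1, h2⟩ := h.dist_le hyopt hz hb (fun i => (hx0 i).le) hx (hunique b) hκ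
      (hysum'.trans hk'k)
    refine ⟨⟨_, (h.ipOptimal hyopt hz hb).1⟩, ?_, h2 hrκ⟩
    rwa [mul_assoc]

theorem exists_ipFeasible_of_distOne_lt {b : Fin m → ℤ} (h : distOne A c b < ∞) :
    ∃ z, IPFeasible A b z := by
  by_contra hne
  have hno : ∀ z, ¬ IPOptimal A c b z := fun z hz => hne ⟨z, hz.1⟩
  simp [distOne, hno] at h

theorem exists_ipFeasible_of_distSup_lt {b : Fin m → ℤ} (h : distSup A c b < ∞) :
    ∃ z, IPFeasible A b z := by
  by_contra hne
  have hno : ∀ z, ¬ IPOptimal A c b z := fun z hz => hne ⟨z, hz.1⟩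
  simp [distSup, hno] at h

theorem le_prLE_dist (hrank : (A.map (Int.cast : ℤ → ℝ)).rank = m)
    (hunique : ∀ b : Fin m → ℤ, (∃ z, IPFeasible A b z) → ∃! x, LPOptimal A c b x) {k : ℕ}
    (hk : (k : ℝ) ≤ normMinor A - 1) :
    ((k : ℝ) + 1) / normMinor A ≤
        prLE (distOne A c) ((m : ℝ) * normMinor A * ((k : ℝ) / ((k : ℝ) + 1)) + (k : ℝ)) ∧
      ((k : ℝ) + 1) / normMinor A ≤
        prLE (distSup A c) (normMinor A * ((k : ℝ) / ((k : ℝ) + 1))) := by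
  have hq : 0 ≤ ((k : ℝ) + 1) / normMinor A :=
    div_nonneg (by positivity) (by linarith [Nat.cast_nonneg (α := ℝ) k])
  constructor
  · refine le_prLE_of_goodSet hrank hunique hq (fun b => exists_ipFeasible_of_distOne_lt)
      fun e u h => ?_
    obtain ⟨Y, h1, h2, h3⟩ := h.exists_goodSet hrank hunique hk
    exact ⟨Y, h1, h2, fun b hb => ⟨(h3 b hb).1, (h3 b hb).2.1⟩⟩
  · refine le_prLE_of_goodSet hrank hunique hq (fun b => exists_ipFeasible_of_distSup_lt)
      fun e u h => ?_
    obtain ⟨Y, h1, h2, h3⟩ := h.exists_goodSet hrank hunique hk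
    exact ⟨Y, h1, h2, fun b hb => ⟨(h3 b hb).1, (h3 b hb).2.2⟩⟩

end

end ParamIP

theorem theorem1p2 {m n : ℕ} (A : Matrix (Fin m) (Fin n) ℤ) (c : Fin n → ℚ)
    (hrank : (A.map (Int.cast : ℤ → ℝ)).rank = m)
    (hc : ∀ x : Fin n → ℝ, (∀ j, 0 ≤ x j) → (A.map (Int.cast : ℤ → ℝ)).mulVec x = 0 →
      ∑ j, (c j : ℝ) * x j ≤ 0)
    (hunique : ∀ b : Fin m → ℤ, (∃ z, IPFeasible A b z) → ∃! x, LPOptimal A c b x) :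
    (∀ k : ℕ, (k : ℝ) ≤ normMinor A - 1 →
      ((k : ℝ) + 1) / normMinor A ≤
          prLE (distOne A c) ((m : ℝ) * normMinor A * ((k : ℝ) / ((k : ℝ) + 1)) + (k : ℝ)) ∧
      ((k : ℝ) + 1) / normMinor A ≤
          prLE (distSup A c) (normMinor A * ((k : ℝ) / ((k : ℝ) + 1)))) ∧
    prLE (distOne A c) (((m : ℝ) + 1) * (normMinor A - 1)) = 1 ∧
    prLE (distSup A c) (normMinor A - 1) = 1 := by
  refine ⟨fun k hk => le_prLE_dist hrank hunique hk, ?_⟩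
  obtain ⟨d, hd⟩ := gcdMinor_dvd_maxMinor hrank
  have hγ : (gcdMinor A : ℝ) ≠ 0 := Nat.cast_ne_zero.2 (gcdMinor_pos hrank).ne'
  have hd0 : d ≠ 0 := fun h => (maxMinor_pos hrank).ne' (by rw [hd, h, mul_zero])
  -- `Δ` is a positive integer, so `k = Δ - 1` is admissible and makes the lower bound equal to `1`.
  obtain ⟨k, rfl⟩ := Nat.exists_eq_succ_of_ne_zero hd0
  have hΔ : normMinor A = (k : ℝ) + 1 := by
    rw [normMinor, hd]
    push_cast
    rw [inv_mul_cancel_left₀ hγ]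
  have hk0 : (k : ℝ) + 1 ≠ 0 := by positivity
  obtain ⟨h1, h2⟩ := le_prLE_dist (c := c) hrank hunique (k := k) (by rw [hΔ]; linarith)
  rw [hΔ] at h1 h2 ⊢
  rw [div_self hk0, mul_assoc, mul_div_cancel₀ _ hk0] at h1
  rw [div_self hk0, mul_div_cancel₀ _ hk0] at h2
  refine ⟨le_antisymm (prLE_le_one _ _) ?_, le_antisymm (prLE_le_one _ _) ?_⟩
  · rwa [show ((m : ℝ) + 1) * ((k : ℝ) + 1 - 1) = m * k + k by ring]
  · rwa [add_sub_cancel_right]
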